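/- Let $\Lambda_{24}\subset\mathbb{R}^{24}$ be the Leech lattice, scaled so that its minimal vectors have length $2$; let $\mathcal{C}$ be the set of its $196560$ minimal vectors, and let $\mathrm{Co}_0$ be the group of distance-preserving bijections $\Lambda_{24}\to\Lambda_{24}$ that fix the origin. Call a set $A\subset\mathcal{C}$ admissible if it is antipodal ($x\in A$ implies $-x\in A$) and $\langle x,y\rangle\le 1$ for all distinct $x,y\in A$. For real $x$ let $\lfloor x\rfloor_2$ be the greatest even integer that is at most $x$. Let $S$ be admissible with $|S|\le 626$ and let $2\le k\le 50$. Let $S_1=S,S_2,\dots,S_k$ be mutually disjoint admissible sets such that each $S_j$ is contained in $g_jS$ for some $g_j\in\mathrm{Co}_0$ (for example $S_j=g_jS\setminus(S_1\cup\dots\cup S_{j-1})$ for $2\le j\le k$, with arbitrary $g_j\in\mathrm{Co}_0$). Put $$E_k=\frac{1}{|\mathrm{Co}_0|}\sum_{g\in \mathrm{Co}_0}\bigl|gS\cap(S_1\cup\dots\cup S_k)\bigr| .$$ If $\lfloor E_k\rfloor$ is even, then there are admissible sets $S_{k+1},S_{k+2}\subset\mathcal{C}$, each contained in $gS$ for some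 $g\in\mathrm{Co}_0$, such that $S_1,\dots,S_{k+2}$ are mutually disjoint and $$E_{k+2}=|S|\,\frac{\sum_{j=1}^{k}|S_j|+2\left(|S|-\lfloor E_k\rfloor_2\right)}{|\mathcal{C}|},$$ $$|S_{k+1}|+|S_{k+2}|\ge 2\left(|S|-\lfloor E_k\rfloor_2\right),\qquad 2|S_{k+1}|+|S_{k+2}|\ge 3\left(|S|-\lfloor E_k\rfloor_2\right),$$ where $E_{k+2}$ is defined as $E_k$ is, with $S_1,\dots,S_{k+2}$ in place of $S_1,\dots,S_k$. Moreover, these sets can be chosen so that either $|S_{k+1}|\ge|S|-\lfloor E_k\rfloor_2$ and $|S_{k+2}|\ge|S|-\lfloor E_k\rfloor_2$, or $|S_{k+1}|\ge|S|-\lfloor E_k\rfloor_2+2$ and $|S_{k+2}|\ge|S|-\lfloor E_k\rfloor_2-2$. -/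

import Mathlib

namespace Leech

noncomputable section

/-- The `a`-th generator of the extended quadratic residue code of length 24. The coordinates
`0, …, 22` are the residues modulo 23, the coordinate `23` is the point at infinity. The generator
is the indicator of `∞` together with all `i` such that `i + a` is a non-residue modulo 23. -/
def golayGen (a : ZMod 23) : Fin 24 → ZMod 2 := fun i =>
  if i = 23 ∨ ¬ IsSquare ((i.val : ZMod 23) + a) then 1 else 0

/-- The extended binary Golay code, as the extended quadratic residue code of length 24: it is
spanned by the 23 generators above and the all-one word. -/
def golayCode : Submodule (ZMod 2) (Fin 24 → ZMod 2) :=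
  Submodule.span (ZMod 2) (insert (fun _ => 1) (Set.range golayGen))

theorem one_mem_golayCode : (fun _ => 1 : Fin 24 → ZMod 2) ∈ golayCode :=
  Submodule.subset_span (Set.mem_insert _ _)

/-- The indicator word of the set of coordinates at which `x` is congruent to `k` modulo 4. -/
def residueWord (x : Fin 24 → ℤ) (k : ℤ) : Fin 24 → ZMod 2 := fun i =>
  if x i ≡ k [ZMOD 4] then 1 else 0

/-- The integral coordinates (that is, before division by `√8`) of the vectors of the Leech lattice:
all coordinates are congruent to some `m` modulo 2, their sum is congruent to `4 m` modulo 8, and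
for each `k` the coordinates congruent to `k` modulo 4 form a word of the Golay code. -/
def IsLeechInt (x : Fin 24 → ℤ) : Prop :=
  ∃ m : ℤ, (∀ i, x i ≡ m [ZMOD 2]) ∧ (∑ i, x i ≡ 4 * m [ZMOD 8]) ∧
    ∀ k : ℤ, residueWord x k ∈ golayCode

theorem IsLeechInt.zero : IsLeechInt 0 := by
  refine ⟨0, fun i => by simp [Int.ModEq], by simp [Int.ModEq], fun k => ?_⟩
  by_cases h : (0 : ℤ) ≡ k [ZMOD 4]
  · have : residueWord 0 k = fun _ => 1 := by funext i; simp [residueWord, h]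
    rw [this]; exact one_mem_golayCode
  · have : residueWord 0 k = 0 := by funext i; simp [residueWord, h]
    rw [this]; exact golayCode.zero_mem

theorem IsLeechInt.neg {x : Fin 24 → ℤ} (hx : IsLeechInt x) : IsLeechInt (-x) := by
  obtain ⟨m, h1, h2, h3⟩ := hx
  refine ⟨-m, fun i => by simpa using (h1 i).neg, ?_, fun k => ?_⟩
  · have := h2.neg
    simpa [Finset.sum_neg_distrib] using this
  · have : residueWord (-x) k = residueWord x (-k) := by
      funext i
      have : (-x) i ≡ k [ZMOD 4] ↔ x i ≡ -k [ZMOD 4] := by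
        simp only [Pi.neg_apply, Int.ModEq]; omega
      simp only [residueWord, this]
    rw [this]; exact h3 _

theorem IsLeechInt.add {x y : Fin 24 → ℤ} (hx : IsLeechInt x) (hy : IsLeechInt y) :
    IsLeechInt (x + y) := by
  obtain ⟨m, h1, h2, h3⟩ := hx
  obtain ⟨n, h1', h2', h3'⟩ := hy
  refine ⟨m + n, fun i => (h1 i).add (h1' i), ?_, fun k => ?_⟩
  · have := h2.add h2'
    simpa [Finset.sum_add_distrib, mul_add] using this
  · by_cases hk : k ≡ m + n [ZMOD 2]
    · have : residueWord (x + y) k =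
          (residueWord x m + residueWord y (k - m)) + fun _ => 1 := by
        funext i
        have e1 := h1 i
        have e2 := h1' i
        by_cases a : x i ≡ m [ZMOD 4] <;> by_cases b : y i ≡ k - m [ZMOD 4]
        all_goals
          have hp : ((x + y) i ≡ k [ZMOD 4]) ↔ ((x i ≡ m [ZMOD 4]) ↔ (y i ≡ k - m [ZMOD 4])) := by
            simp only [Pi.add_apply, Int.ModEq] at *; omega
          simp only [Pi.add_apply] at hp ⊢
          simp [residueWord, hp, a, b]
        all_goals decide
      rw [this]
      exact golayCode.add_mem (golayCode.add_mem (h3 _) (h3' _)) one_mem_golayCode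
    · have : residueWord (x + y) k = 0 := by
        funext i
        have e1 := h1 i
        have e2 := h1' i
        have hp : ¬ ((x + y) i ≡ k [ZMOD 4]) := by
          simp only [Pi.add_apply, Int.ModEq] at *; omega
        simp only [residueWord, if_neg hp, Pi.zero_apply]
      rw [this]; exact golayCode.zero_mem

/-- The Leech lattice in Euclidean 24-space, scaled so that its minimal vectors have length 2. -/
def leechLattice : AddSubgroup (EuclideanSpace ℝ (Fin 24)) where
  carrier := {v | ∃ x : Fin 24 → ℤ, IsLeechInt x ∧ ∀ i, v i = (x i : ℝ) / Real.sqrt 8}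
  zero_mem' := ⟨0, IsLeechInt.zero, fun i => by simp⟩
  add_mem' := by
    rintro v w ⟨x, hx, hv⟩ ⟨y, hy, hw⟩
    exact ⟨x + y, hx.add hy, fun i => by simp [hv i, hw i, add_div]⟩
  neg_mem' := by
    rintro v ⟨x, hx, hv⟩
    exact ⟨-x, hx.neg, fun i => by simp [hv i, neg_div]⟩

/-- The set `𝒞` of minimal vectors: the nonzero lattice vectors of least length. -/
def minimalVectors : Set leechLattice :=
  {x | x ≠ 0 ∧ ∀ y : leechLattice, y ≠ 0 → ‖x‖ ≤ ‖y‖}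

/-- The Conway group `Co₀`: the distance preserving bijections of the Leech lattice onto itself
which fix the origin. -/
def Co0 : Subgroup (leechLattice ≃ᵢ leechLattice) where
  carrier := {g | g 0 = 0}
  one_mem' := rfl
  mul_mem' := by
    intro a b ha hb
    change a (b 0) = 0
    rw [show b 0 = 0 from hb]; exact ha
  inv_mem' := by
    intro a ha
    exact (IsometryEquiv.symm_apply_eq a).2 (Eq.symm ha)

/-- The translate `g S`. -/
def translate (g : Co0) (S : Set leechLattice) : Set leechLattice :=
  (fun x => (g : leechLattice ≃ᵢ leechLattice) x) '' S

/-- Antipodal sets of minimal vectors any two distinct elements of which have inner product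
at most 1. -/
structure IsAdmissible (S : Set leechLattice) : Prop where
  minimal : S ⊆ minimalVectors
  antipodal : ∀ x ∈ S, -x ∈ S
  inner_le : ∀ x ∈ S, ∀ y ∈ S, x ≠ y →
    inner ℝ (x : EuclideanSpace ℝ (Fin 24)) (y : EuclideanSpace ℝ (Fin 24)) ≤ 1

/-- `T 1, …, T k` is a sequence of mutually disjoint admissible sets that starts with `S` and in
which each set is part of a translate of `S` under `Co₀`. (The values `T j` for `j = 0` and `j > k`
play no role.) Typical example: `T j = g_j S \ (T 1 ∪ ⋯ ∪ T (j - 1))` for `j ≥ 2`. -/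
structure IsDisjointSystem (S : Set leechLattice) (T : ℕ → Set leechLattice) (k : ℕ) : Prop where
  first : T 1 = S
  admissible : ∀ j ∈ Finset.Icc 1 k, IsAdmissible (T j)
  subset_translate : ∀ j ∈ Finset.Icc 1 k, ∃ g : Co0, T j ⊆ translate g S
  disjoint : ∀ i ∈ Finset.Icc 1 k, ∀ j ∈ Finset.Icc 1 k, i ≠ j → Disjoint (T i) (T j)

/-- `E_k`, the average of `|g S ∩ (T 1 ∪ ⋯ ∪ T k)|` over the (finite) group `Co₀`. -/
def expectedOverlap (S : Set leechLattice) (T : ℕ → Set leechLattice) (k : ℕ) : ℝ :=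
  (∑ᶠ g : Co0, ((translate g S ∩ ⋃ j ∈ Finset.Icc 1 k, T j).ncard : ℝ)) / (Nat.card Co0 : ℝ)

/-- `⌊x⌋₂`, the greatest even integer that is at most `x`. -/
def evenFloor (x : ℝ) : ℤ := 2 * ⌊x / 2⌋

theorem isGreatest_evenFloor (x : ℝ) : IsGreatest {n : ℤ | Even n ∧ (n : ℝ) ≤ x} (evenFloor x) := by
  refine ⟨⟨even_two_mul _, ?_⟩, ?_⟩
  · have := Int.floor_le (x / 2)
    simp only [evenFloor]; push_cast; linarith
  · rintro n ⟨⟨r, rfl⟩, h⟩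
    have : r ≤ ⌊x / 2⌋ := Int.le_floor.2 (by push_cast at h; linarith)
    simp only [evenFloor]; omega

end

end Leech

/-!
The group `Co₀` acts transitively on the `196560` minimal vectors, so by double counting the average
of `|g S ∩ U|` over `g ∈ Co₀` is `|S| |U| / |𝒞|` for every set `U` of minimal vectors. For antipodal
sets all these overlaps are even. If the floor `m` of the average is even, there are thus two cases.
Either some overlap is at most `m - 2`; then a part of that translate of size `|S| - m + 2` avoids
`U`, and adding it to `U` raises the average by less than `2`, which leaves room for a second part
of size `|S| - m - 2`. Or all overlaps are at least `m`; then more than half of them equal `m`. As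
`|S|² < 2 |𝒞|`, some translate `h S` is disjoint from `S`, and `g` and `g h` both have overlap `m`
for some `g`, so that `g S \ U` and `g h S \ U` are as required.

Transitivity is seen by scaling the coordinates to integers and applying three kinds of isometries:
sign changes on the words of the Golay code, the cyclic shift of 23 coordinates, and the map that
subtracts from each coordinate half the sum over its tetrad of a sextet and negates one tetrad. The
last map, applied after a suitable shift, removes a factor 2 common to all coordinates of a short
vector. Once a coordinate is odd, so are all, and sign changes make them congruent to 1 modulo 4;
then a vector whose squares add up to 32 has one coordinate -3 and all others 1.
-/

namespace Leech

open scoped Pointwise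
open MulAction (orbit stabilizer)

/-! ### Overlaps of the translates of a set under a finite group -/

section Action

variable {G M : Type*} [Group G] [MulAction G M]

theorem card_smul_eq_mul_ncard_orbit {a x y : M} (hx : x ∈ orbit G a) (hy : y ∈ orbit G a) :
    Nat.card {g : G // g • x = y} * (orbit G a).ncard = Nat.card G := by
  rw [← MulAction.orbit_eq_iff.2 hx] at hy ⊢
  obtain ⟨h, rfl⟩ := hy
  have e : {g : G // g • x = h • x} ≃ stabilizer G x :=
    (Equiv.mulLeft h⁻¹).subtypeEquiv fun g => by
      rw [MulAction.mem_stabilizer_iff, Equiv.coe_mulLeft, mul_smul, inv_smul_eq_iff]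
  rw [Nat.card_congr e, ← MulAction.index_stabilizer, Subgroup.card_mul_index]

theorem exists_mem_mul_mem_of_card_lt [Fintype G] {A : Finset G}
    (hA : Fintype.card G < 2 * A.card) (h : G) : ∃ g ∈ A, g * h ∈ A := by
  classical
  have hcard : (Finset.univ : Finset G).card < (A.image (· * h)).card + A.card := by
    rw [Finset.card_image_of_injective _ (mul_left_injective h), Finset.card_univ]
    omega
  obtain ⟨x, hx⟩ := Finset.inter_nonempty_of_card_lt_card_add_card
    (Finset.subset_univ _) (Finset.subset_univ _) hcard
  obtain ⟨hx, hxA⟩ := Finset.mem_inter.1 hx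
  obtain ⟨g, hg, rfl⟩ := Finset.mem_image.1 hx
  exact ⟨g, hg, hxA⟩

variable {a : M} {S U : Set M}

theorem finite_of_subset_orbit [Finite G] (hS : S ⊆ orbit G a) : S.Finite :=
  (Set.finite_range _).subset hS

theorem sum_ncard_smul_inter_mul_ncard_orbit [Fintype G] (hS : S ⊆ orbit G a)
    (hU : U ⊆ orbit G a) :
    (∑ g : G, (g • S ∩ U).ncard) * (orbit G a).ncard =
      Fintype.card G * (S.ncard * U.ncard) := by
  classical
  lift S to Finset M using finite_of_subset_orbit hS
  lift U to Finset M using finite_of_subset_orbit hU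
  let r (g : G) (p : M × M) : Prop := g • p.1 = p.2
  have overlap (g : G) :
      (g • (S : Set M) ∩ U).ncard = ((S ×ˢ U).bipartiteAbove r g).card := by
    have himage : g • (S : Set M) ∩ U = ((S ×ˢ U).bipartiteAbove r g).image Prod.snd := by
      ext y
      simp only [Set.mem_inter_iff, Set.mem_smul_set, SetLike.mem_coe, Finset.coe_image,
        Set.mem_image, Finset.mem_bipartiteAbove, Finset.mem_product, Prod.exists, r]
      exact ⟨fun ⟨⟨x, hx, hxy⟩, hy⟩ => ⟨x, y, ⟨⟨hx, hy⟩, hxy⟩, rfl⟩,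
        fun ⟨x, _, ⟨⟨hx, hy⟩, hxy⟩, h⟩ => h ▸ ⟨⟨x, hx, hxy⟩, hy⟩⟩
    rw [himage, Set.ncard_coe_finset, Finset.card_image_of_injOn]
    rintro ⟨x, y⟩ hxy ⟨x', y'⟩ hxy' (rfl : y = y')
    have h₁ : g • x = y := ((Finset.mem_bipartiteAbove r).1 hxy).2
    have h₂ : g • x' = y := ((Finset.mem_bipartiteAbove r).1 hxy').2
    exact Prod.ext (smul_left_cancel g (h₁.trans h₂.symm)) rfl
  have fibre : ∀ p ∈ S ×ˢ U,
      (Finset.univ.bipartiteBelow r p).card * (orbit G a).ncard = Fintype.card G := by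
    intro p hp
    obtain ⟨hx, hy⟩ := Finset.mem_product.1 hp
    rw [← Nat.card_eq_fintype_card, ← card_smul_eq_mul_ncard_orbit (hS hx) (hU hy),
      Nat.card_eq_fintype_card, Fintype.card_subtype]
    rfl
  rw [Finset.sum_congr rfl fun g _ => overlap g,
    Finset.sum_card_bipartiteAbove_eq_sum_card_bipartiteBelow, Finset.sum_mul,
    Finset.sum_congr rfl fibre, Finset.sum_const, Finset.card_product, smul_eq_mul, mul_comm,
    Set.ncard_coe_finset, Set.ncard_coe_finset]

theorem card_lt_two_mul_card_ncard_smul_inter_eq [Fintype G] (hS : S ⊆ orbit G a)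
    (hU : U ⊆ orbit G a) {m : ℕ} (heven : ∀ g : G, Even (g • S ∩ U).ncard) (hm : Even m)
    (hlt : S.ncard * U.ncard < (m + 1) * (orbit G a).ncard)
    (hle : ∀ g : G, m ≤ (g • S ∩ U).ncard) :
    Fintype.card G < 2 * (Finset.univ.filter fun g : G => (g • S ∩ U).ncard = m).card := by
  -- An overlap different from `m` is at least `m + 2`, but the mean overlap is less than `m + 1`.
  have hpoint (g : G) : m + 2 ≤ (g • S ∩ U).ncard + if (g • S ∩ U).ncard = m then 2 else 0 := by
    obtain ⟨r, hr⟩ := heven g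
    obtain ⟨q, rfl⟩ := hm
    have := hle g
    split_ifs <;> omega
  have hsum : Fintype.card G * (m + 2) ≤ ∑ g : G, (g • S ∩ U).ncard +
      (Finset.univ.filter fun g : G => (g • S ∩ U).ncard = m).card * 2 := by
    rw [← smul_eq_mul (Finset.card _), ← Finset.sum_const, Finset.sum_filter,
      ← Finset.sum_add_distrib, ← smul_eq_mul, ← Finset.card_univ, ← Finset.sum_const]
    exact Finset.sum_le_sum fun g _ => hpoint g
  have htotal := sum_ncard_smul_inter_mul_ncard_orbit hS hU
  have hG : 0 < Fintype.card G := Fintype.card_pos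
  have : ∑ g : G, (g • S ∩ U).ncard < Fintype.card G * (m + 1) := by
    refine Nat.lt_of_mul_lt_mul_right (a := (orbit G a).ncard) ?_
    rw [htotal, mul_assoc]
    exact Nat.mul_lt_mul_of_pos_left hlt hG
  linarith

variable [Finite G]

theorem ncard_orbit_pos (a : M) : 0 < (orbit G a).ncard :=
  (Set.ncard_pos (Set.finite_range _)).2 (MulAction.nonempty_orbit a)

theorem exists_ncard_smul_inter_lt (hS : S ⊆ orbit G a) (hU : U ⊆ orbit G a) {r : ℕ}
    (hr : S.ncard * U.ncard < r * (orbit G a).ncard) : ∃ g : G, (g • S ∩ U).ncard < r := by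
  have := Fintype.ofFinite G
  by_contra! hge
  have hsum : Fintype.card G * r ≤ ∑ g : G, (g • S ∩ U).ncard := by
    simpa using Finset.card_nsmul_le_sum Finset.univ _ r fun g _ => hge g
  have htotal := sum_ncard_smul_inter_mul_ncard_orbit hS hU
  have hG : 0 < Fintype.card G := Fintype.card_pos
  have := Nat.mul_le_mul_right (orbit G a).ncard hsum
  nlinarith [Nat.mul_lt_mul_of_pos_left hr hG]

theorem exists_lt_ncard_smul_inter (hS : S ⊆ orbit G a) (hU : U ⊆ orbit G a) {m : ℕ}
    (hm : m * (orbit G a).ncard ≤ S.ncard * U.ncard) {g₀ : G} (hg₀ : (g₀ • S ∩ U).ncard < m) :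
    ∃ g : G, m < (g • S ∩ U).ncard := by
  have := Fintype.ofFinite G
  by_contra! hle
  have hsum : ∑ g : G, (g • S ∩ U).ncard < Fintype.card G * m := by
    simpa using Finset.sum_lt_sum (g := fun _ => m) (fun g _ => hle g)
      ⟨g₀, Finset.mem_univ g₀, hg₀⟩
  have htotal := sum_ncard_smul_inter_mul_ncard_orbit hS hU
  have := Nat.mul_lt_mul_of_pos_right hsum (ncard_orbit_pos (G := G) a)
  nlinarith [Nat.mul_le_mul_left (Fintype.card G) hm]

theorem ncard_smul_inter_add_ncard_sdiff (hS : S ⊆ orbit G a) (g : G) :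
    (g • S ∩ U).ncard + (g • S \ U).ncard = S.ncard := by
  rw [Set.ncard_inter_add_ncard_sdiff_eq_ncard _ _ (finite_of_subset_orbit hS).smul_set,
    Set.ncard_smul_set]

theorem exists_disjoint_smul (hS : S ⊆ orbit G a) (hsq : S.ncard ^ 2 < 2 * (orbit G a).ncard)
    (heven : ∀ g : G, Even (g • S ∩ S).ncard) : ∃ h : G, Disjoint (h • S) S := by
  obtain ⟨h, hh⟩ := exists_ncard_smul_inter_lt hS hS (by rwa [← sq])
  obtain ⟨r, hr⟩ := heven h
  have hempty : (h • S ∩ S).ncard = 0 := by omega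
  rw [Set.ncard_eq_zero ((finite_of_subset_orbit hS).inter_of_right _)] at hempty
  exact ⟨h, Set.disjoint_iff_inter_eq_empty.2 hempty⟩

end Action

section Antipodal

theorem even_ncard_of_neg_eq {M : Type*} [InvolutiveNeg M] {W : Set M} (hW : -W = W)
    (hne : ∀ x ∈ W, -x ≠ x) : Even W.ncard := by
  rcases W.finite_or_infinite with hfin | hinf
  · lift W to Finset M using hfin
    have hneg : ∀ x ∈ W, -x ∈ W := fun x hx => by
      have : -x ∈ -(W : Set M) := Set.neg_mem_neg.2 hx
      rwa [hW] at this
    rw [Set.ncard_coe_finset, ← ZMod.natCast_eq_zero_iff_even, Finset.cast_card]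
    exact Finset.sum_involution (fun x _ => -x) (fun _ _ => rfl) (fun x hx _ => hne x hx) hneg
      fun x _ => neg_neg x
  · simp [hinf.ncard]

theorem exists_neg_eq_subset_ncard_eq {M : Type*} [InvolutiveNeg M] {W : Set M} (hW : -W = W)
    (hne : ∀ x ∈ W, -x ≠ x) {n : ℕ} (hn : Even n) (hcard : n ≤ W.ncard) :
    ∃ A ⊆ W, -A = A ∧ A.ncard = n := by
  obtain ⟨r, rfl⟩ := hn
  induction r with
  | zero => exact ⟨∅, Set.empty_subset W, Set.neg_empty, Set.ncard_empty M⟩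
  | succ r ih =>
    obtain ⟨A, hAW, hA, hAr⟩ := ih (by omega)
    have hfinA : A.Finite := (Set.finite_of_ncard_pos (by omega)).subset hAW
    obtain ⟨x, hxW, hxA⟩ := Set.exists_mem_notMem_of_ncard_lt_ncard
      (show A.ncard < W.ncard by omega) hfinA
    have hxA' : -x ∉ A := fun h => hxA (by rwa [← hA, Set.mem_neg])
    have hxW' : -x ∈ W := by rwa [← hW, Set.neg_mem_neg]
    refine ⟨insert x (insert (-x) A), ?_, ?_, ?_⟩
    · exact Set.insert_subset hxW (Set.insert_subset hxW' hAW)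
    · rw [Set.neg_insert, Set.neg_insert, neg_neg, hA, Set.insert_comm]
    · rw [Set.ncard_insert_of_notMem _ (hfinA.insert _), Set.ncard_insert_of_notMem hxA' hfinA]
      · omega
      · simpa [hxA] using (hne x hxW).symm

/-- `A` is an antipodal part of a translate of `S` that avoids `U`: what the construction of the
paper may add to a union `U` of parts of translates of `S` already chosen. -/
structure IsAntipodalPart (G : Type*) {M : Type*} [SMul G M] [Neg M] (S U A : Set M) : Prop where
  subset_smul : ∃ g : G, A ⊆ g • S
  neg_eq : -A = A
  disjoint : Disjoint A U

variable {G M : Type*} [Group G] [AddGroup M] [DistribMulAction G M] {a : M} {S U : Set M}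

theorem neg_ne_self_of_mem_orbit (ha : -a ≠ a) {x : M} (hx : x ∈ orbit G a) : -x ≠ x := by
  obtain ⟨g, rfl⟩ := hx
  rw [← smul_neg]
  exact fun h => ha (smul_left_cancel g h)

theorem smul_subset_orbit (hS : S ⊆ orbit G a) (g : G) : g • S ⊆ orbit G a := by
  rw [← MulAction.smul_orbit g a]
  exact Set.smul_set_mono hS

theorem even_ncard_smul_inter (ha : -a ≠ a) (hS : S ⊆ orbit G a) (hSneg : -S = S) (hU : -U = U)
    (g : G) : Even (g • S ∩ U).ncard := by
  refine even_ncard_of_neg_eq (by rw [Set.inter_neg, ← Set.smul_set_neg, hSneg, hU]) fun x hx => ?_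
  exact neg_ne_self_of_mem_orbit ha (smul_subset_orbit hS g hx.1)

theorem neg_smul_sdiff (hSneg : -S = S) (hUneg : -U = U) (g : G) :
    -(g • S \ U) = g • S \ U := by
  rw [Set.sdiff_eq, Set.inter_neg, Set.compl_neg, ← Set.smul_set_neg, hSneg, hUneg]

variable [Finite G]

theorem exists_isAntipodalPart (ha : -a ≠ a) (hS : S ⊆ orbit G a) (hSneg : -S = S) (hUneg : -U = U)
    {g : G} {n : ℕ} (hn : Even n) (hcard : n + (g • S ∩ U).ncard ≤ S.ncard) :
    ∃ A, IsAntipodalPart G S U A ∧ A.ncard = n := by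
  have hsplit := ncard_smul_inter_add_ncard_sdiff (U := U) hS g
  obtain ⟨A, hA, hAneg, rfl⟩ := exists_neg_eq_subset_ncard_eq (neg_smul_sdiff hSneg hUneg g)
    (fun x hx => neg_ne_self_of_mem_orbit ha (smul_subset_orbit hS g hx.1)) hn (by omega)
  exact ⟨A, ⟨⟨g, hA.trans Set.sdiff_subset⟩, hAneg, Set.disjoint_sdiff_left.mono_left hA⟩, rfl⟩

/-- If every overlap is at least `m`, then more than half of all overlaps equal `m`, so they do so
for two elements `g` and `g h` where `h S` is disjoint from `S`. -/
theorem exists_isAntipodalPart_pair_of_le (ha : -a ≠ a) (hS : S ⊆ orbit G a) (hU : U ⊆ orbit G a)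
    (hSneg : -S = S) (hUneg : -U = U) (hsq : S.ncard ^ 2 < 2 * (orbit G a).ncard) {m : ℕ}
    (hm : Even m) (hlt : S.ncard * U.ncard < (m + 1) * (orbit G a).ncard)
    (hle : ∀ g : G, m ≤ (g • S ∩ U).ncard) :
    ∃ A B, IsAntipodalPart G S U A ∧ IsAntipodalPart G S (U ∪ A) B ∧
      A.ncard + m = S.ncard ∧ B.ncard + m = S.ncard := by
  have := Fintype.ofFinite G
  obtain ⟨h, hh⟩ := exists_disjoint_smul hS hsq (even_ncard_smul_inter ha hS hSneg hSneg)
  obtain ⟨g, hg, hgh⟩ := exists_mem_mul_mem_of_card_lt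
    (card_lt_two_mul_card_ncard_smul_inter_eq hS hU
      (even_ncard_smul_inter ha hS hSneg hUneg) hm hlt hle) h
  have hgh_disj : Disjoint ((g * h) • S) (g • S) := by
    rwa [mul_smul, Set.disjoint_smul_set]
  have hcard {g : G} (hg : g ∈ Finset.univ.filter fun g : G => (g • S ∩ U).ncard = m) :
      (g • S \ U).ncard + m = S.ncard := by
    rw [← (Finset.mem_filter.1 hg).2, add_comm, ncard_smul_inter_add_ncard_sdiff hS]
  refine ⟨g • S \ U, (g * h) • S \ U,
    ⟨⟨g, Set.sdiff_subset⟩, neg_smul_sdiff hSneg hUneg g, Set.disjoint_sdiff_left⟩,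
    ⟨⟨g * h, Set.sdiff_subset⟩, neg_smul_sdiff hSneg hUneg _,
      Set.disjoint_union_right.2 ⟨Set.disjoint_sdiff_left, ?_⟩⟩,
    hcard hg, hcard hgh⟩
  exact hgh_disj.mono Set.sdiff_subset Set.sdiff_subset

/-- An overlap below `m` leaves room for a part with two elements more, and the second part is then
cut from a translate whose overlap with `U ∪ A` is at most `m + 2`. -/
theorem exists_isAntipodalPart_pair_of_lt (ha : -a ≠ a) (hS : S ⊆ orbit G a) (hU : U ⊆ orbit G a)
    (hSneg : -S = S) (hUneg : -U = U) (hsq : S.ncard ^ 2 < 2 * (orbit G a).ncard) {m : ℕ}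
    (hm : Even m) (hle : m * (orbit G a).ncard ≤ S.ncard * U.ncard)
    (hlt : S.ncard * U.ncard < (m + 1) * (orbit G a).ncard)
    {g : G} (hg : (g • S ∩ U).ncard < m) :
    ∃ A B, IsAntipodalPart G S U A ∧ IsAntipodalPart G S (U ∪ A) B ∧
      A.ncard + m = S.ncard + 2 ∧ B.ncard + m + 2 = S.ncard := by
  have heven := even_ncard_smul_inter ha hS hSneg hUneg
  have hSeven : Even S.ncard := by simpa using even_ncard_smul_inter ha hS hSneg hSneg (1 : G)
  have hgap : (g • S ∩ U).ncard + 2 ≤ m := by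
    obtain ⟨r, hr⟩ := heven g
    obtain ⟨q, rfl⟩ := hm
    omega
  obtain ⟨n, hn⟩ : ∃ n, S.ncard = m + 2 + n := by
    obtain ⟨g', hg'⟩ := exists_lt_ncard_smul_inter hS hU hle hg
    have hmS := hg'.trans_le (le_of_le_of_eq (Nat.le_add_right _ _)
      (ncard_smul_inter_add_ncard_sdiff (U := U) hS g'))
    refine Nat.exists_eq_add_of_le ?_
    obtain ⟨s, hs⟩ := hSeven
    obtain ⟨q, rfl⟩ := hm
    omega
  have hneven : Even n := by
    rw [hn, Nat.even_add, Nat.even_add] at hSeven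
    exact hSeven.1 (by simp [hm])
  obtain ⟨A, hA, hAcard⟩ := exists_isAntipodalPart ha hS hSneg hUneg (g := g) (n := n + 4)
    (hneven.add (by decide)) (by omega)
  have hAU : (U ∪ A) ⊆ orbit G a := by
    obtain ⟨g', hg'⟩ := hA.subset_smul
    exact Set.union_subset hU (hg'.trans (smul_subset_orbit hS g'))
  have hAUneg : -(U ∪ A) = U ∪ A := by rw [Set.union_neg, hUneg, hA.neg_eq]
  have hmean : S.ncard * (U ∪ A).ncard < (m + 3) * (orbit G a).ncard := by
    have hAS : A.ncard ≤ S.ncard := by omega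
    have := Nat.mul_le_mul_left S.ncard (Set.ncard_union_le U A)
    nlinarith [Nat.mul_le_mul_left S.ncard hAS]
  obtain ⟨g', hg'⟩ := exists_ncard_smul_inter_lt hS hAU hmean
  obtain ⟨B, hB, hBcard⟩ := exists_isAntipodalPart ha hS hSneg hAUneg (g := g') hneven (by omega)
  exact ⟨A, B, hA, hB, by omega, by omega⟩

theorem exists_isAntipodalPart_pair (ha : -a ≠ a) (hS : S ⊆ orbit G a) (hU : U ⊆ orbit G a)
    (hSneg : -S = S) (hUneg : -U = U) (hsq : S.ncard ^ 2 < 2 * (orbit G a).ncard) {m : ℕ}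
    (hm : Even m) (hle : m * (orbit G a).ncard ≤ S.ncard * U.ncard)
    (hlt : S.ncard * U.ncard < (m + 1) * (orbit G a).ncard) :
    ∃ A B, IsAntipodalPart G S U A ∧ IsAntipodalPart G S (U ∪ A) B ∧
      (A.ncard + m = S.ncard ∧ B.ncard + m = S.ncard ∨
        A.ncard + m = S.ncard + 2 ∧ B.ncard + m + 2 = S.ncard) := by
  by_cases hall : ∀ g : G, m ≤ (g • S ∩ U).ncard
  · obtain ⟨A, B, hA, hB, h⟩ :=
      exists_isAntipodalPart_pair_of_le ha hS hU hSneg hUneg hsq hm hlt hall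
    exact ⟨A, B, hA, hB, .inl h⟩
  · push Not at hall
    obtain ⟨g, hg⟩ := hall
    obtain ⟨A, B, hA, hB, h⟩ :=
      exists_isAntipodalPart_pair_of_lt ha hS hU hSneg hUneg hsq hm hle hlt hg
    exact ⟨A, B, hA, hB, .inr h⟩

end Antipodal

/-! ### The Golay code -/

theorem zmod_two_eq_zero_or_one (a : ZMod 2) : a = 0 ∨ a = 1 := by
  revert a
  decide

/-- The binary word of length 24 whose support is given by the binary digits of `n`; this encoding
makes the finite checks on the Golay code computable. -/
def word (n : ℕ) : Fin 24 → ZMod 2 := fun i => if n.testBit i then 1 else 0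

theorem word_zero : word 0 = 0 := by
  funext i
  simp [word]

theorem word_xor (m n : ℕ) : word (m ^^^ n) = word m + word n := by
  funext i
  simp only [word, Nat.testBit_xor, Pi.add_apply]
  cases m.testBit i <;> cases n.testBit i <;> decide

theorem word_injOn : Set.InjOn word (Set.Iio (2 ^ 24)) := by
  intro m hm n hn h
  refine Nat.eq_of_testBit_eq fun i => ?_
  by_cases hi : i < 24
  · have := congrFun h ⟨i, hi⟩
    simp only [word] at this
    revert this
    cases m.testBit i <;> cases n.testBit i <;> simp
  · have hpow : 2 ^ 24 ≤ 2 ^ i := Nat.pow_le_pow_right (by norm_num) (by omega)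
    rw [Nat.testBit_lt_two_pow (lt_of_lt_of_le hm hpow),
      Nat.testBit_lt_two_pow (lt_of_lt_of_le hn hpow)]

/-- The number of ones among the last `k` binary digits. -/
def bitCount : ℕ → ℕ → ℕ
  | 0, _ => 0
  | k + 1, n => n % 2 + bitCount k (n / 2)

theorem card_filter_testBit (k n : ℕ) :
    (Finset.univ.filter fun i : Fin k => n.testBit i = true).card = bitCount k n := by
  induction k generalizing n with
  | zero => rfl
  | succ k ih =>
    rw [Fin.card_filter_univ_succ, bitCount, ← ih]
    simp only [Fin.val_succ, Nat.testBit_succ, Fin.val_zero, Nat.testBit_zero, decide_eq_true_eq]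
    split_ifs <;> omega

theorem hammingNorm_word (n : ℕ) : hammingNorm (word n) = bitCount 24 n := by
  rw [← card_filter_testBit, hammingNorm]
  exact congrArg Finset.card (Finset.filter_congr fun i _ => by simp [word])

/-- The encodings of all sums of sublists of a list of encoded words. -/
def xorSpan : List ℕ → List ℕ
  | [] => [0]
  | g :: l => xorSpan l ++ (xorSpan l).map (· ^^^ g)

theorem mem_span_word_iff {l : List ℕ} {w : Fin 24 → ZMod 2} :
    w ∈ Submodule.span (ZMod 2) (word '' {n | n ∈ l}) ↔ ∃ n ∈ xorSpan l, word n = w := by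
  induction l generalizing w with
  | nil => simp [xorSpan, word_zero, eq_comm]
  | cons g l ih =>
    have hinsert : {n | n ∈ g :: l} = insert g {n | n ∈ l} := by ext; simp
    rw [hinsert, Set.image_insert_eq, Submodule.mem_span_insert]
    simp only [ih, xorSpan, List.mem_append, List.mem_map]
    constructor
    · rintro ⟨c, _, ⟨n, hn, rfl⟩, rfl⟩
      rcases zmod_two_eq_zero_or_one c with rfl | rfl
      · exact ⟨n, .inl hn, by simp⟩
      · exact ⟨n ^^^ g, .inr ⟨n, hn, rfl⟩, by rw [word_xor, one_smul, add_comm]⟩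
    · rintro ⟨_, hn | ⟨n, hn, rfl⟩, rfl⟩
      · exact ⟨0, _, ⟨_, hn, rfl⟩, by simp⟩
      · exact ⟨1, _, ⟨n, hn, rfl⟩, by rw [word_xor, one_smul, add_comm]⟩

/-- The encoding of `golayGen a`. The list consists of the squares modulo 23. -/
def golayGenNat (a : ℕ) : ℕ :=
  2 ^ 23 + ((List.range 23).map fun i =>
    if (i + a) % 23 ∈ [0, 1, 2, 3, 4, 6, 8, 9, 12, 13, 16, 18] then 0 else 2 ^ i).sum

theorem word_golayGenNat (a : ZMod 23) : word (golayGenNat a.val) = golayGen a := by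
  funext i
  revert a i
  unfold golayGen
  decide +kernel

theorem word_two_pow_sub_one : word (2 ^ 24 - 1) = fun _ => 1 := by
  decide +kernel

theorem golayGen_mem_golayCode (a : ZMod 23) : golayGen a ∈ golayCode :=
  Submodule.subset_span (Set.mem_insert_of_mem _ ⟨a, rfl⟩)

/-- A basis of the Golay code that is in echelon form with respect to the coordinates
`0, …, 11`. -/
def golayBasis : List ℕ :=
  [14919680, 11654144, 8077824, 4038912, 2019456, 15515712, 11952160, 10170384, 7221256,
    13938692, 4845570, 13062145]

/-- The encodings of the words of the Golay code. -/
@[irreducible]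
def golayNat : List ℕ := xorSpan golayBasis

theorem golayGenNat_mem_golayNat : ∀ a < 23, golayGenNat a ∈ golayNat := by
  decide +kernel

theorem two_pow_sub_one_mem_golayNat : 2 ^ 24 - 1 ∈ golayNat := by
  decide +kernel

theorem golayBasis_subset_xorSpan : ∀ n ∈ golayBasis,
    n ∈ xorSpan ((2 ^ 24 - 1) :: (List.range 11).map golayGenNat) := by
  decide +kernel

theorem golayCode_eq_span_golayBasis :
    golayCode = Submodule.span (ZMod 2) (word '' {n | n ∈ golayBasis}) := by
  refine le_antisymm (Submodule.span_le.2 ?_) (Submodule.span_le.2 ?_)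
  · rintro w (rfl | ⟨a, rfl⟩)
    all_goals rw [SetLike.mem_coe, mem_span_word_iff, ← golayNat]
    · exact ⟨_, two_pow_sub_one_mem_golayNat, word_two_pow_sub_one⟩
    · exact ⟨_, golayGenNat_mem_golayNat _ a.val_lt, word_golayGenNat a⟩
  · rintro _ ⟨n, hn, rfl⟩
    refine Submodule.span_le.2 ?_ (mem_span_word_iff.2 ⟨n, golayBasis_subset_xorSpan n hn, rfl⟩)
    rintro _ ⟨n, hn, rfl⟩
    rcases List.mem_cons.1 hn with rfl | hn
    · rw [word_two_pow_sub_one]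
      exact one_mem_golayCode
    · obtain ⟨a, ha, rfl⟩ := List.mem_map.1 hn
      have hval : (a : ZMod 23).val = a :=
        ZMod.val_cast_of_lt ((List.mem_range.1 ha).trans (by norm_num))
      rw [← hval, word_golayGenNat]
      exact golayGen_mem_golayCode a

theorem mem_golayCode_iff {w : Fin 24 → ZMod 2} : w ∈ golayCode ↔ ∃ n ∈ golayNat, word n = w := by
  rw [golayCode_eq_span_golayBasis, mem_span_word_iff, golayNat]

theorem four_dvd_bitCount_of_mem_golayNat : ∀ n ∈ golayNat, 4 ∣ bitCount 24 n := by
  have : golayNat.all (fun n => 4 ∣ bitCount 24 n) = true := by decide +kernel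
  simpa only [List.all_eq_true, decide_eq_true_eq] using this

theorem four_dvd_hammingNorm {w : Fin 24 → ZMod 2} (hw : w ∈ golayCode) : 4 ∣ hammingNorm w := by
  obtain ⟨n, hn, rfl⟩ := mem_golayCode_iff.1 hw
  rw [hammingNorm_word]
  exact four_dvd_bitCount_of_mem_golayNat n hn

/-- The words of the Golay code as a finite set. -/
def golayFinset : Finset (Fin 24 → ZMod 2) := golayNat.toFinset.image word

theorem mem_golayFinset {w : Fin 24 → ZMod 2} : w ∈ golayFinset ↔ w ∈ golayCode := by
  simp only [golayFinset, Finset.mem_image, List.mem_toFinset, mem_golayCode_iff]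

theorem map_mod_golayNat : golayNat.map (· % 4096) = List.range 4096 :=
  beq_iff_eq.1 (by decide +kernel)

theorem golayNat_nodup : golayNat.Nodup :=
  List.Nodup.of_map (· % 4096) (map_mod_golayNat ▸ List.nodup_range)

theorem golayNat_lt : ∀ n ∈ golayNat, n < 2 ^ 24 := by
  have : golayNat.all (fun n => n < 2 ^ 24) = true := by decide +kernel
  simpa only [List.all_eq_true, decide_eq_true_eq] using this

theorem card_filter_golayFinset (p : (Fin 24 → ZMod 2) → Prop) [DecidablePred p] :
    (golayFinset.filter p).card = golayNat.countP fun n => p (word n) := by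
  rw [golayFinset, Finset.filter_image, Finset.card_image_of_injOn, List.countP_eq_length_filter,
    ← List.toFinset_card_of_nodup (golayNat_nodup.filter _), List.toFinset_filter]
  · simp only [decide_eq_true_eq]
  · refine word_injOn.mono fun n hn => golayNat_lt n ?_
    exact List.mem_toFinset.1 (Finset.mem_filter.1 hn).1

theorem card_golayFinset : golayFinset.card = 4096 := by
  have hall := card_filter_golayFinset fun _ => True
  rw [Finset.filter_true_of_mem fun _ _ => trivial] at hall
  simpa [hall] using congrArg List.length map_mod_golayNat

theorem countP_bitCount_eq_eight : (golayNat.countP fun n => bitCount 24 n = 8) = 759 := by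
  decide +kernel

theorem card_filter_hammingNorm_eq_eight :
    (golayFinset.filter fun w => hammingNorm w = 8).card = 759 := by
  rw [card_filter_golayFinset]
  simp only [hammingNorm_word, countP_bitCount_eq_eight]

/-- The cyclic shift of the coordinates `0, …, 22`. -/
def cyc : Equiv.Perm (Fin 24) where
  toFun i := if i.val < 23 then ⟨(i.val + 1) % 23, by omega⟩ else i
  invFun i := if i.val < 23 then ⟨(i.val + 22) % 23, by omega⟩ else i
  left_inv := by decide +kernel
  right_inv := by decide +kernel

theorem golayGen_comp_cyc (a : ZMod 23) : golayGen a ∘ cyc = golayGen (a + 1) := by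
  have : ∀ (a : ZMod 23) (i : Fin 24), golayGen a (cyc i) = golayGen (a + 1) i := by
    unfold golayGen
    decide +kernel
  exact funext (this a)

theorem comp_perm_mem {σ : Equiv.Perm (Fin 24)} (hσ : ∀ a, golayGen a ∘ σ ∈ golayCode)
    {w : Fin 24 → ZMod 2} (hw : w ∈ golayCode) : w ∘ σ ∈ golayCode := by
  induction hw using Submodule.span_induction with
  | mem w h =>
    rcases h with rfl | ⟨a, rfl⟩
    · exact one_mem_golayCode
    · exact hσ a
  | zero => exact golayCode.zero_mem
  | add v w _ _ hv hw => exact golayCode.add_mem hv hw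
  | smul c w _ hw => exact golayCode.smul_mem c hw

/-- The group of the permutations of the coordinates that preserve the Golay code (the Mathieu group
`M₂₄`). -/
def golayAut : Subgroup (Equiv.Perm (Fin 24)) where
  carrier := {σ | ∀ w : Fin 24 → ZMod 2, w ∘ σ ∈ golayCode ↔ w ∈ golayCode}
  one_mem' _ := Iff.rfl
  mul_mem' {σ _} hσ hτ w := (hτ (w ∘ σ)).trans (hσ w)
  inv_mem' {σ} hσ w := by
    rw [← hσ, Function.comp_assoc, ← Equiv.Perm.coe_mul, inv_mul_cancel, Equiv.Perm.coe_one,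
      Function.comp_id]

theorem cyc_mem_golayAut : cyc ∈ golayAut := by
  intro w
  refine ⟨fun hw => ?_, comp_perm_mem fun a =>
    golayGen_comp_cyc a ▸ golayGen_mem_golayCode (a + 1)⟩
  have hinv (a : ZMod 23) : golayGen a ∘ cyc.symm ∈ golayCode := by
    rw [← sub_add_cancel a 1, ← golayGen_comp_cyc, Function.comp_assoc, Equiv.self_comp_symm,
      Function.comp_id]
    exact golayGen_mem_golayCode (a - 1)
  simpa [Function.comp_assoc] using comp_perm_mem hinv hw

/-- The block of a coordinate in a sextet: a partition of the coordinates into six tetrads such that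
the union of any two of them supports a word of the Golay code. -/
def sextet : Fin 24 → Fin 6 :=
  ![0, 0, 0, 2, 1, 2, 3, 3, 5, 4, 4, 5, 5, 1, 2, 4, 1, 2, 5, 3, 4, 3, 1, 0]

/-- The tetrads of the sextet. -/
def tetrad (b : Fin 6) : Finset (Fin 24) := Finset.univ.filter fun i => sextet i = b

theorem mem_tetrad {b : Fin 6} {i : Fin 24} : i ∈ tetrad b ↔ sextet i = b := by
  simp [tetrad]

theorem card_tetrad (b : Fin 6) : (tetrad b).card = 4 := by
  revert b
  decide +kernel

theorem tetrad_zero : tetrad 0 = {0, 1, 2, 23} := by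
  decide +kernel

/-- The indicator word of a tetrad. -/
def tetradWord (b : Fin 6) : Fin 24 → ZMod 2 := fun i => if sextet i = b then 1 else 0

theorem tetradWord_add_tetradWord_zero_mem (b : Fin 6) :
    tetradWord b + tetradWord 0 ∈ golayCode := by
  let tetradNat (b : Fin 6) : ℕ :=
    ((List.finRange 24).map fun i => if sextet i = b then 2 ^ i.val else 0).sum
  have hword : ∀ b, word (tetradNat b) = tetradWord b := by decide +kernel
  have hmem : ∀ b, tetradNat b ^^^ tetradNat 0 ∈ golayNat := by decide +kernel
  exact mem_golayCode_iff.2 ⟨_, hmem b, by rw [word_xor, hword, hword]⟩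

theorem comp_sextet_mem {f : Fin 6 → ZMod 2} (hf : ∑ b, f b = 0) : f ∘ sextet ∈ golayCode := by
  have hsum : f ∘ sextet = ∑ b, f b • (tetradWord b + tetradWord 0) := by
    funext i
    simp [tetradWord, Finset.sum_add_distrib, hf]
  rw [hsum]
  exact golayCode.sum_mem fun b _ => golayCode.smul_mem _ (tetradWord_add_tetradWord_zero_mem b)

/-! ### Symmetries of the lattice in integral coordinates -/

theorem val_add_eq_sub (a b : ZMod 2) :
    ((a + b).val : ℤ) = a.val + b.val - 2 * (a.val * b.val) := by
  revert a b
  decide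

theorem val_add_intCast_modEq (a : ZMod 2) (z : ℤ) :
    ((a + (z : ZMod 2)).val : ℤ) ≡ a.val + z [ZMOD 2] :=
  (ZMod.intCast_eq_intCast_iff _ _ 2).1 (by simp)

theorem hammingNorm_eq_sum_val (w : Fin 24 → ZMod 2) :
    (hammingNorm w : ℤ) = ∑ i, ((w i).val : ℤ) := by
  have hval (a : ZMod 2) : (a.val : ℤ) = if a ≠ 0 then 1 else 0 := by revert a; decide
  simp only [hval, Finset.sum_boole, hammingNorm]

theorem isLeechInt_iff {x : Fin 24 → ℤ} :
    IsLeechInt x ↔ ∃ m : ℤ, ∃ c ∈ golayCode,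
      (∀ i, x i ≡ m + 2 * (c i).val [ZMOD 4]) ∧ ∑ i, x i ≡ 4 * m [ZMOD 8] := by
  constructor
  · rintro ⟨m, hpar, hsum, hres⟩
    refine ⟨m, residueWord x (m + 2), hres _, fun i => ?_, hsum⟩
    have hi := hpar i
    unfold residueWord
    split_ifs with h
    · simpa only [ZMod.val_one, Nat.cast_one, mul_one] using h
    · simp only [Int.ModEq, ZMod.val_zero, Nat.cast_zero] at *
      omega
  · rintro ⟨m, c, hc, hres, hsum⟩
    refine ⟨m, fun i => ?_, hsum, fun k => ?_⟩
    · have hi := hres i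
      simp only [Int.ModEq] at *
      omega
    · have hcode : residueWord x k =
          if k ≡ m [ZMOD 4] then c + (fun _ => 1) else if k ≡ m + 2 [ZMOD 4] then c else 0 := by
        funext i
        have hi := hres i
        rcases zmod_two_eq_zero_or_one (c i) with hci | hci <;> rw [hci] at hi <;>
          unfold residueWord <;> split_ifs <;> simp only [Pi.add_apply, Pi.zero_apply, hci] <;>
          first
          | rfl
          | simp only [Int.ModEq, ZMod.val_zero, ZMod.val_one, Nat.cast_zero, Nat.cast_one] at *
            omega
      rw [hcode]
      split_ifs
      exacts [golayCode.add_mem hc one_mem_golayCode, hc, golayCode.zero_mem]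

theorem IsLeechInt.four_dvd_sum_codeword {x : Fin 24 → ℤ} (hx : IsLeechInt x)
    {w : Fin 24 → ZMod 2} (hw : w ∈ golayCode) : (4 : ℤ) ∣ ∑ i, (w i).val * x i := by
  obtain ⟨m, c, hc, hres, -⟩ := isLeechInt_iff.1 hx
  have hmod : ∑ i, ((w i).val : ℤ) * x i ≡ ∑ i, ((w i).val : ℤ) * (m + 2 * (c i).val) [ZMOD 4] :=
    Int.ModEq.sum fun i _ => (hres i).mul_left _
  have hnorm : ∑ i, ((w i).val : ℤ) * (m + 2 * (c i).val) =
      m * hammingNorm w + (hammingNorm w + hammingNorm c - hammingNorm (w + c)) := by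
    simp only [hammingNorm_eq_sum_val, Finset.mul_sum, Pi.add_apply, val_add_eq_sub,
      ← Finset.sum_add_distrib, ← Finset.sum_sub_distrib]
    exact Finset.sum_congr rfl fun i _ => by ring
  have hdvd {v : Fin 24 → ZMod 2} (hv : v ∈ golayCode) : (4 : ℤ) ∣ hammingNorm v :=
    Int.natCast_dvd_natCast.2 (four_dvd_hammingNorm hv)
  refine hmod.dvd_iff.2 ?_
  rw [hnorm]
  exact dvd_add ((hdvd hw).mul_left _)
    (dvd_sub (dvd_add (hdvd hw) (hdvd hc)) (hdvd (golayCode.add_mem hw hc)))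

/-- The change of signs on the support of a binary word. -/
def signChange (w : Fin 24 → ZMod 2) (x : Fin 24 → ℤ) : Fin 24 → ℤ := fun i =>
  (1 - 2 * (w i).val) * x i

theorem one_sub_two_mul_val_sq (a : ZMod 2) : (1 - 2 * (a.val : ℤ)) ^ 2 = 1 := by
  revert a
  decide

theorem signChange_signChange (w : Fin 24 → ZMod 2) (x : Fin 24 → ℤ) :
    signChange w (signChange w x) = x := by
  funext i
  rw [signChange, signChange, ← mul_assoc, ← sq, one_sub_two_mul_val_sq, one_mul]

theorem signChange_add (w : Fin 24 → ZMod 2) (x y : Fin 24 → ℤ) :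
    signChange w (x + y) = signChange w x + signChange w y :=
  funext fun _ => mul_add _ _ _

theorem signChange_sq (w : Fin 24 → ZMod 2) (x : Fin 24 → ℤ) (i : Fin 24) :
    signChange w x i ^ 2 = x i ^ 2 := by
  rw [signChange, mul_pow, one_sub_two_mul_val_sq, one_mul]

theorem IsLeechInt.signChange {x : Fin 24 → ℤ} (hx : IsLeechInt x) {w : Fin 24 → ZMod 2}
    (hw : w ∈ golayCode) : IsLeechInt (signChange w x) := by
  have hdvd := hx.four_dvd_sum_codeword hw
  obtain ⟨m, c, hc, hres, hsum⟩ := isLeechInt_iff.1 hx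
  refine isLeechInt_iff.2 ⟨m, c + (m : ZMod 2) • w, golayCode.add_mem hc (golayCode.smul_mem _ hw),
    fun i => ?_, ?_⟩
  · have hval := val_add_intCast_modEq (c i) (m * (w i).val)
    push_cast [ZMod.natCast_zmod_val] at hval
    have hi := hres i
    simp only [Leech.signChange, Pi.add_apply, Pi.smul_apply, smul_eq_mul]
    generalize (c i + (m : ZMod 2) * w i).val = v at hval ⊢
    rcases zmod_two_eq_zero_or_one (w i) with hwi | hwi <;>
      simp only [hwi, Int.ModEq, ZMod.val_zero, ZMod.val_one, Nat.cast_zero, Nat.cast_one] at * <;>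
      omega
  · have hsub : ∑ i, Leech.signChange w x i = ∑ i, x i - 2 * ∑ i, (w i).val * x i := by
      rw [Finset.mul_sum, ← Finset.sum_sub_distrib]
      exact Finset.sum_congr rfl fun i _ => by rw [Leech.signChange]; ring
    rw [hsub]
    simp only [Int.ModEq] at *
    omega

theorem IsLeechInt.comp_perm {x : Fin 24 → ℤ} (hx : IsLeechInt x) {σ : Equiv.Perm (Fin 24)}
    (hσ : σ ∈ golayAut) : IsLeechInt (x ∘ σ) := by
  obtain ⟨m, c, hc, hres, hsum⟩ := isLeechInt_iff.1 hx
  refine isLeechInt_iff.2 ⟨m, c ∘ σ, (hσ c).2 hc, fun i => hres (σ i), ?_⟩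
  rwa [← Equiv.sum_comp σ x] at hsum

/-- The sum of the coordinates of a vector over a tetrad of the sextet. -/
def tetradSum (x : Fin 24 → ℤ) (b : Fin 6) : ℤ := ∑ i ∈ tetrad b, x i

theorem sum_tetradSum (x : Fin 24 → ℤ) : ∑ b, tetradSum x b = ∑ i, x i :=
  Finset.sum_fiberwise Finset.univ sextet x

theorem tetradSum_sub_const (x : Fin 24 → ℤ) (a : ℤ) (b : Fin 6) :
    ∑ i ∈ tetrad b, (x i - a) = tetradSum x b - 4 * a := by
  rw [Finset.sum_sub_distrib, Finset.sum_const, card_tetrad, tetradSum, nsmul_eq_mul,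
    Nat.cast_ofNat]

theorem IsLeechInt.two_dvd_tetradSum {x : Fin 24 → ℤ} (hx : IsLeechInt x) (b : Fin 6) :
    2 ∣ tetradSum x b := by
  obtain ⟨m, hpar, -, -⟩ := hx
  have hdvd : 2 ∣ ∑ i ∈ tetrad b, (x i - m) := Finset.dvd_sum fun i _ => (hpar i).symm.dvd
  rw [tetradSum_sub_const] at hdvd
  omega

theorem IsLeechInt.four_dvd_tetradSum_add {x : Fin 24 → ℤ} (hx : IsLeechInt x) (b : Fin 6) :
    4 ∣ tetradSum x b + tetradSum x 0 := by
  rcases eq_or_ne b 0 with rfl | hb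
  · have := hx.two_dvd_tetradSum 0
    omega
  · have hval (i : Fin 24) : (((tetradWord b + tetradWord 0) i).val : ℤ) =
        (if sextet i = b then 1 else 0) + if sextet i = 0 then 1 else 0 := by
      rcases eq_or_ne (sextet i) 0 with hi | hi
      · simp [tetradWord, hi, hb.symm, ZMod.val_one]
      · by_cases hib : sextet i = b <;>
          simp [tetradWord, hi, hib, hb, show (1 : ZMod 2).val = 1 from rfl]
    have hdvd := hx.four_dvd_sum_codeword (tetradWord_add_tetradWord_zero_mem b)
    simpa only [hval, add_mul, ite_mul, one_mul, zero_mul, Finset.sum_add_distrib,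
      ← Finset.sum_filter, tetradSum, tetrad] using hdvd

/-- The automorphism of the lattice attached to a sextet: half the sum over the tetrad of a
coordinate is subtracted from it, and then the signs are changed on the first tetrad. The division
is exact for vectors of the lattice. -/
def sextetMap (x : Fin 24 → ℤ) : Fin 24 → ℤ := fun i =>
  (if sextet i = 0 then -1 else 1) * (x i - tetradSum x (sextet i) / 2)

theorem tetradSum_sextetMap {x : Fin 24 → ℤ} (hx : IsLeechInt x) (b : Fin 6) :
    tetradSum (sextetMap x) b = (if b = 0 then -1 else 1) * -tetradSum x b := by
  have hconst : tetradSum (sextetMap x) b =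
      (if b = 0 then -1 else 1) * ∑ i ∈ tetrad b, (x i - tetradSum x b / 2) := by
    rw [Finset.mul_sum]
    exact Finset.sum_congr rfl fun i hi => by rw [sextetMap, mem_tetrad.1 hi]
  have heven := hx.two_dvd_tetradSum b
  rw [hconst, tetradSum_sub_const]
  congr 1
  omega

theorem sextetMap_sextetMap {x : Fin 24 → ℤ} (hx : IsLeechInt x) :
    sextetMap (sextetMap x) = x := by
  funext i
  have heven := hx.two_dvd_tetradSum (sextet i)
  rw [sextetMap, tetradSum_sextetMap hx, sextetMap]
  split_ifs <;> omega

theorem sextetMap_add {x : Fin 24 → ℤ} (hx : IsLeechInt x) (y : Fin 24 → ℤ) :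
    sextetMap (x + y) = sextetMap x + sextetMap y := by
  funext i
  have hadd : tetradSum (x + y) (sextet i) = tetradSum x (sextet i) + tetradSum y (sextet i) :=
    Finset.sum_add_distrib
  have hdiv := Int.add_ediv_of_dvd_left (c := 2) (b := tetradSum y (sextet i))
    (hx.two_dvd_tetradSum (sextet i))
  simp only [sextetMap, Pi.add_apply, hadd, hdiv]
  ring

theorem sum_sextetMap_sq {x : Fin 24 → ℤ} (hx : IsLeechInt x) :
    ∑ i, sextetMap x i ^ 2 = ∑ i, x i ^ 2 := by
  rw [← Finset.sum_fiberwise _ sextet, ← Finset.sum_fiberwise _ sextet (fun i => x i ^ 2)]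
  refine Finset.sum_congr rfl fun b _ => ?_
  obtain ⟨h, hh⟩ := hx.two_dvd_tetradSum b
  have hsq : ∀ i ∈ tetrad b, sextetMap x i ^ 2 = x i ^ 2 - 2 * h * (x i - h) - h ^ 2 := by
    intro i hi
    rw [sextetMap, mem_tetrad.1 hi, hh, Int.mul_ediv_cancel_left _ two_ne_zero]
    split_ifs <;> ring
  calc ∑ i ∈ tetrad b, sextetMap x i ^ 2
      = ∑ i ∈ tetrad b, x i ^ 2 - 2 * h * ∑ i ∈ tetrad b, (x i - h) - 4 * h ^ 2 := by
        rw [Finset.sum_congr rfl hsq, Finset.sum_sub_distrib, Finset.sum_sub_distrib,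
          Finset.mul_sum, Finset.sum_const, card_tetrad, nsmul_eq_mul, Nat.cast_ofNat]
    _ = ∑ i ∈ tetrad b, x i ^ 2 := by
        rw [tetradSum_sub_const, hh]
        ring

theorem IsLeechInt.sextetMap {x : Fin 24 → ℤ} (hx : IsLeechInt x) : IsLeechInt (sextetMap x) := by
  choose h hh using hx.two_dvd_tetradSum
  have hq (b : Fin 6) : 2 ∣ h b + h 0 := by
    have := hx.four_dvd_tetradSum_add b
    rw [hh, hh] at this
    omega
  choose q hq using hq
  obtain ⟨m, c, hc, hres, hsum⟩ := isLeechInt_iff.1 hx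
  rw [← sum_tetradSum] at hsum
  let f : Fin 6 → ℤ := fun b => q b + if b = 0 then m + h 0 else 0
  have hf : ∑ b, (f b : ZMod 2) = 0 := by
    rw [← Int.cast_sum, ZMod.intCast_zmod_eq_zero_iff_dvd]
    have hq₀ : ∑ b, (h b + h 0) = 2 * ∑ b, q b := by simp only [hq, Finset.mul_sum]
    have hfsum : ∑ b, f b = ∑ b, q b + (m + h 0) := by simp [f, Finset.sum_add_distrib]
    simp only [hh, ← Finset.mul_sum, Finset.sum_add_distrib, Finset.sum_const, Finset.card_univ,
      Fintype.card_fin, nsmul_eq_mul, Nat.cast_ofNat, Int.ModEq] at hsum hq₀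
    rw [hfsum]
    omega
  refine isLeechInt_iff.2 ⟨m + h 0, c + (fun b => (f b : ZMod 2)) ∘ sextet,
    golayCode.add_mem hc (comp_sextet_mem hf), fun i => ?_, ?_⟩
  · have hi := hres i
    have hval := val_add_intCast_modEq (c i) (f (sextet i))
    have hqi := hq (sextet i)
    rw [Leech.sextetMap, hh, Int.mul_ediv_cancel_left _ two_ne_zero]
    simp only [Pi.add_apply, Function.comp_apply]
    generalize (c i + (f (sextet i) : ZMod 2)).val = v at hval ⊢
    simp only [f, Int.ModEq] at *
    split_ifs at * with h0
    · simp only [h0] at hval hqi ⊢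
      omega
    · omega
  · have hneg : ∑ b, tetradSum (Leech.sextetMap x) b = 4 * h 0 - ∑ b, tetradSum x b := by
      simp only [tetradSum_sextetMap hx, Fin.sum_univ_succ, hh]
      simp
      ring
    rw [← sum_tetradSum, hneg]
    simp only [Int.ModEq] at *
    omega

/-! ### The Conway group -/

theorem finite_of_finite_orbit {G M : Type*} [Group G] [AddGroup M] [DistribMulAction G M]
    [FaithfulSMul G M] [AddGroup.FG M] (h : ∀ x : M, (orbit G x).Finite) : Finite G := by
  obtain ⟨s, hs⟩ := AddGroup.fg_def.1 ‹AddGroup.FG M›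
  have (x : M) : Finite (orbit G x) := h x
  refine Finite.of_injective (β := ∀ x : s, orbit G (x : M))
    (fun g x => ⟨g • (x : M), MulAction.mem_orbit _ g⟩) fun g₁ g₂ hg => ?_
  have heq : DistribSMul.toAddMonoidHom M g₁ = DistribSMul.toAddMonoidHom M g₂ :=
    AddMonoidHom.eq_of_eqOn_dense hs fun x hx => congrArg Subtype.val (congrFun hg ⟨x, hx⟩)
  exact FaithfulSMul.eq_of_smul_eq_smul fun x => DFunLike.congr_fun heq x

section Isometry

variable {E F : Type*} [NormedAddCommGroup E] [InnerProductSpace ℝ E] [NormedAddCommGroup F]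
  [InnerProductSpace ℝ F] {L : AddSubgroup E} {f : L → F}

theorem inner_map_of_isometry (hf : Isometry f) (h0 : f 0 = 0) (v w : L) :
    inner ℝ (f v) (f w) = inner ℝ (v : E) (w : E) := by
  have hdist : ‖f v - f w‖ = ‖(v : E) - w‖ := by simpa [dist_eq_norm] using hf.dist_eq v w
  simp only [real_inner_eq_norm_mul_self_add_norm_mul_self_sub_norm_sub_mul_self_div_two, hdist,
    hf.norm_map_of_map_zero h0, AddSubgroup.norm_coe]

theorem map_add_of_isometry (hf : Isometry f) (h0 : f 0 = 0) (v w : L) :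
    f (v + w) = f v + f w := by
  have hzero : inner ℝ (f (v + w) - (f v + f w)) (f (v + w) - (f v + f w)) = 0 := by
    simp only [inner_sub_left, inner_sub_right, inner_add_left, inner_add_right,
      inner_map_of_isometry hf h0, AddSubgroup.coe_add]
    ring
  exact sub_eq_zero.1 (inner_self_eq_zero.1 hzero)

end Isometry

noncomputable instance : MulAction Co0 leechLattice where
  smul g x := g.1 x
  one_smul _ := rfl
  mul_smul _ _ _ := rfl

theorem smul_eq_apply (g : Co0) (x : leechLattice) : g • x = g.1 x := rfl

theorem isometry_smul (g : Co0) : Isometry fun x : leechLattice => g • x := g.1.isometry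

noncomputable instance : DistribMulAction Co0 leechLattice where
  smul_zero g := g.2
  smul_add g x y := Subtype.ext <|
    map_add_of_isometry (f := fun z => ((g • z : leechLattice) : EuclideanSpace ℝ (Fin 24)))
      (isometry_subtype_coe.comp (isometry_smul g)) (congrArg Subtype.val g.2) x y

instance : FaithfulSMul Co0 leechLattice where
  eq_of_smul_eq_smul h := Subtype.ext (IsometryEquiv.ext fun x => h x)

theorem norm_smul_leechLattice (g : Co0) (x : leechLattice) : ‖g • x‖ = ‖x‖ :=
  (isometry_smul g).norm_map_of_map_zero (smul_zero g) x

theorem translate_eq_smul (g : Co0) (S : Set leechLattice) : translate g S = g • S := rfl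

theorem smul_mem_minimalVectors (g : Co0) {x : leechLattice} (hx : x ∈ minimalVectors) :
    g • x ∈ minimalVectors := by
  refine ⟨(smul_ne_zero_iff_ne g).2 hx.1, fun y hy => ?_⟩
  rw [norm_smul_leechLattice]
  exact hx.2 y hy

/-- The vectors of the Leech lattice in integral coordinates. -/
def leechInts : AddSubgroup (Fin 24 → ℤ) where
  carrier := {x | IsLeechInt x}
  zero_mem' := IsLeechInt.zero
  add_mem' hx hy := hx.add hy
  neg_mem' hx := hx.neg

/-- The passage from integral coordinates to the Leech lattice. -/
noncomputable def toLeech : leechInts ≃+ leechLattice :=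
  AddEquiv.ofBijective
    ({ toFun x := ⟨WithLp.toLp 2 fun i => (x.1 i : ℝ) / √8, x.1, x.2, fun _ => rfl⟩
       map_zero' := by ext; simp
       map_add' x y := by ext; simp [add_div] } : leechInts →+ leechLattice)
    ⟨fun x y h => Subtype.ext <| funext fun i => by
      have hi := congrArg (fun v : leechLattice => (v : EuclideanSpace ℝ (Fin 24)) i) h
      simpa using hi,
     fun v => by
      obtain ⟨v, x, hx, hv⟩ := v
      exact ⟨⟨x, hx⟩, Subtype.ext (PiLp.ext fun i => (hv i).symm)⟩⟩

theorem norm_toLeech_sq (x : leechInts) : ‖toLeech x‖ ^ 2 = (∑ i, x.1 i ^ 2 : ℤ) / 8 := by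
  have hcoord (i : Fin 24) :
      (toLeech x : EuclideanSpace ℝ (Fin 24)) i = (x.1 i : ℝ) / √8 := rfl
  have h8 : √8 ^ 2 = 8 := Real.sq_sqrt (by norm_num)
  simp only [← AddSubgroup.norm_coe, EuclideanSpace.real_norm_sq_eq, hcoord, div_pow, h8,
    ← Finset.sum_div]
  push_cast
  rfl

theorem norm_toLeech_le_iff {x y : leechInts} :
    ‖toLeech x‖ ≤ ‖toLeech y‖ ↔ ∑ i, x.1 i ^ 2 ≤ ∑ i, y.1 i ^ 2 := by
  rw [← sq_le_sq₀ (norm_nonneg _) (norm_nonneg _), norm_toLeech_sq, norm_toLeech_sq,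
    div_le_div_iff_of_pos_right (by norm_num), Int.cast_le]

theorem finite_setOf_norm_le (r : ℝ) : {v : leechLattice | ‖v‖ ≤ r}.Finite := by
  obtain ⟨n, hn⟩ := exists_nat_ge (r ^ 2 * 8)
  have hbox : {x : leechInts | x.1 ∈ Set.Icc (fun _ => -(n : ℤ)) fun _ => (n : ℤ)}.Finite :=
    (Set.finite_Icc _ _).preimage Subtype.val_injective.injOn
  refine (hbox.image toLeech).subset fun v hv => ?_
  obtain ⟨x, rfl⟩ := toLeech.surjective v
  have hsum : ∑ i, x.1 i ^ 2 ≤ n := by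
    have hsq : ‖toLeech x‖ ^ 2 ≤ r ^ 2 := pow_le_pow_left₀ (norm_nonneg _) hv 2
    rw [norm_toLeech_sq] at hsq
    exact_mod_cast (by linarith : ((∑ i, x.1 i ^ 2 : ℤ) : ℝ) ≤ n)
  have hcoord (i : Fin 24) : |x.1 i| ≤ n := by
    have hi := Finset.single_le_sum (f := fun i => x.1 i ^ 2) (fun i _ => sq_nonneg _)
      (Finset.mem_univ i)
    exact ((Int.le_self_sq _).trans (sq_abs _).le).trans (hi.trans hsum)
  exact ⟨x, ⟨fun i => (abs_le.1 (hcoord i)).1, fun i => (abs_le.1 (hcoord i)).2⟩, rfl⟩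

theorem finite_minimalVectors : minimalVectors.Finite := by
  rcases minimalVectors.eq_empty_or_nonempty with h | ⟨v, hv⟩
  · exact h ▸ Set.finite_empty
  · exact (finite_setOf_norm_le ‖v‖).subset fun x hx => hx.2 v hv.1

instance : AddGroup.FG leechLattice := by
  have : Module.Finite ℤ leechInts :=
    inferInstanceAs (Module.Finite ℤ (AddSubgroup.toIntSubmodule leechInts))
  have : AddGroup.FG leechInts := Module.Finite.iff_addGroup_fg.1 this
  exact AddGroup.fg_of_surjective (f := toLeech.toAddMonoidHom) toLeech.surjective

instance : Finite Co0 :=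
  finite_of_finite_orbit (M := leechLattice) fun v => (finite_setOf_norm_le ‖v‖).subset <| by
    rintro _ ⟨g, rfl⟩
    exact (norm_smul_leechLattice g v).le

theorem sum_sq_eq_of_orbit_eq {x y : leechInts}
    (h : orbit Co0 (toLeech x) = orbit Co0 (toLeech y)) : ∑ i, x.1 i ^ 2 = ∑ i, y.1 i ^ 2 := by
  obtain ⟨g, hg⟩ := MulAction.orbit_eq_iff.1 h
  have hnorm : ‖toLeech x‖ = ‖toLeech y‖ := by
    rw [← hg]
    exact norm_smul_leechLattice g _
  exact le_antisymm (norm_toLeech_le_iff.1 hnorm.le) (norm_toLeech_le_iff.1 hnorm.ge)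

theorem orbit_toLeech_map_eq (f : leechInts ≃+ leechInts)
    (hf : ∀ x, ∑ i, (f x).1 i ^ 2 = ∑ i, x.1 i ^ 2) (x : leechInts) :
    orbit Co0 (toLeech (f x)) = orbit Co0 (toLeech x) := by
  let F : leechLattice ≃+ leechLattice := (toLeech.symm.trans f).trans toLeech
  have hF : Isometry F := AddMonoidHomClass.isometry_of_norm F fun v => by
    obtain ⟨y, rfl⟩ := toLeech.surjective v
    have hy : F (toLeech y) = toLeech (f y) := by simp [F]
    rw [hy]
    exact le_antisymm (norm_toLeech_le_iff.2 (hf y).le) (norm_toLeech_le_iff.2 (hf y).ge)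
  exact MulAction.orbit_eq_iff.2 ⟨⟨⟨F.toEquiv, hF⟩, F.map_zero⟩, by simp [smul_eq_apply, F]⟩

/-- The automorphism that changes the signs on the support of a word of the Golay code. -/
def signChangeEquiv {w : Fin 24 → ZMod 2} (hw : w ∈ golayCode) : leechInts ≃+ leechInts where
  toFun x := ⟨signChange w x.1, x.2.signChange hw⟩
  invFun x := ⟨signChange w x.1, x.2.signChange hw⟩
  left_inv x := Subtype.ext (signChange_signChange w x.1)
  right_inv x := Subtype.ext (signChange_signChange w x.1)
  map_add' x y := Subtype.ext (signChange_add w x.1 y.1)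

/-- The automorphism that permutes the coordinates by an automorphism of the Golay code. -/
def permEquiv {σ : Equiv.Perm (Fin 24)} (hσ : σ ∈ golayAut) : leechInts ≃+ leechInts where
  toFun x := ⟨x.1 ∘ σ, x.2.comp_perm hσ⟩
  invFun x := ⟨x.1 ∘ (σ⁻¹ : Equiv.Perm (Fin 24)), x.2.comp_perm (inv_mem hσ)⟩
  left_inv x := Subtype.ext <| funext fun i => by simp
  right_inv x := Subtype.ext <| funext fun i => by simp
  map_add' _ _ := rfl

/-- The automorphism attached to the sextet. -/
def sextetEquiv : leechInts ≃+ leechInts where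
  toFun x := ⟨sextetMap x.1, x.2.sextetMap⟩
  invFun x := ⟨sextetMap x.1, x.2.sextetMap⟩
  left_inv x := Subtype.ext (sextetMap_sextetMap x.2)
  right_inv x := Subtype.ext (sextetMap_sextetMap x.2)
  map_add' x y := Subtype.ext (sextetMap_add x.2 y.1)

theorem orbit_toLeech_signChangeEquiv {w : Fin 24 → ZMod 2} (hw : w ∈ golayCode) (x : leechInts) :
    orbit Co0 (toLeech (signChangeEquiv hw x)) = orbit Co0 (toLeech x) :=
  orbit_toLeech_map_eq _ (fun x => Finset.sum_congr rfl fun i _ => signChange_sq w x.1 i) x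

theorem orbit_toLeech_permEquiv {σ : Equiv.Perm (Fin 24)} (hσ : σ ∈ golayAut) (x : leechInts) :
    orbit Co0 (toLeech (permEquiv hσ x)) = orbit Co0 (toLeech x) :=
  orbit_toLeech_map_eq _ (fun x => Equiv.sum_comp σ fun i => x.1 i ^ 2) x

theorem orbit_toLeech_sextetEquiv (x : leechInts) :
    orbit Co0 (toLeech (sextetEquiv x)) = orbit Co0 (toLeech x) :=
  orbit_toLeech_map_eq _ (fun x => sum_sextetMap_sq x.2) x

/-! ### Transitivity on the vectors of norm at most 2 -/

/-- The vector `(-3, 1, …, 1)` of the Leech lattice, with its entry `-3` at `j`. -/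
def oddVec (j : Fin 24) : leechInts :=
  ⟨fun i => if i = j then -3 else 1, isLeechInt_iff.2 ⟨1, 0, golayCode.zero_mem, fun i => by
    split_ifs <;> rfl, by revert j; decide +kernel⟩⟩

theorem oddVec_apply (j i : Fin 24) : (oddVec j).1 i = if i = j then -3 else 1 := rfl

theorem sum_oddVec_sq (j : Fin 24) : ∑ i, (oddVec j).1 i ^ 2 = 32 := by
  revert j
  decide +kernel

theorem permEquiv_oddVec {σ : Equiv.Perm (Fin 24)} (hσ : σ ∈ golayAut) (j : Fin 24) :
    permEquiv hσ (oddVec (σ j)) = oddVec j :=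
  Subtype.ext <| funext fun _ => if_congr σ.injective.eq_iff rfl rfl

theorem IsLeechInt.exists_signChange_modEq_one {x : Fin 24 → ℤ} (hx : IsLeechInt x) {j : Fin 24}
    (hj : Odd (x j)) : ∃ w ∈ golayCode, ∀ i, Leech.signChange w x i ≡ 1 [ZMOD 4] := by
  obtain ⟨m, hm, -, hres⟩ := hx
  refine ⟨residueWord x 3, hres 3, fun i => ?_⟩
  have hi : x i ≡ x j [ZMOD 2] := (hm i).trans (hm j).symm
  obtain ⟨n, hn⟩ := hj
  by_cases h : x i ≡ 3 [ZMOD 4]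
  · simp only [Leech.signChange, residueWord, if_pos h, ZMod.val_one]
    simp only [Int.ModEq] at h ⊢
    omega
  · simp only [Leech.signChange, residueWord, if_neg h, ZMod.val_zero]
    simp only [Int.ModEq] at h hi ⊢
    omega

theorem IsLeechInt.exists_eq_oddVec {x : Fin 24 → ℤ} (hx : IsLeechInt x)
    (h1 : ∀ i, x i ≡ 1 [ZMOD 4]) (hle : ∑ i, x i ^ 2 ≤ 32) : ∃ k, x = (oddVec k).1 := by
  choose z hz using fun i => Int.modEq_iff_add_fac.1 (h1 i).symm
  obtain ⟨m, hm, hsum, -⟩ := hx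
  obtain ⟨k, hk⟩ : ∃ k, z k ≠ 0 := by
    by_contra! h0
    have h24 : ∑ i, x i = 24 := by simp [hz, h0]
    have hm0 := (h1 0).of_mul_left 2 |>.symm.trans (hm 0)
    simp only [Int.ModEq] at hsum hm0
    omega
  have hsq (i : Fin 24) : (oddVec k).1 i ^ 2 ≤ x i ^ 2 := by
    rw [oddVec_apply, hz]
    split_ifs with h
    · subst h
      rcases lt_or_gt_of_ne hk with h | h <;> nlinarith
    · rcases lt_trichotomy (z i) 0 with h | h | h
      · nlinarith
      · simp [h]
      · nlinarith
  have heq := (Finset.sum_eq_sum_iff_of_le fun i _ => hsq i).1 <|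
    (Finset.sum_le_sum fun i _ => hsq i).antisymm (hle.trans_eq (sum_oddVec_sq k).symm)
  refine ⟨k, funext fun i => ?_⟩
  rcases sq_eq_sq_iff_eq_or_eq_neg.1 (heq i (Finset.mem_univ i)) with h | h
  · exact h.symm
  · have hi := h1 i
    rw [oddVec_apply] at h ⊢
    simp only [Int.ModEq] at hi
    split_ifs at h ⊢ <;> omega

theorem exists_signChangeEquiv_eq_oddVec {x : leechInts} {j : Fin 24} (hj : Odd (x.1 j))
    (hle : ∑ i, x.1 i ^ 2 ≤ 32) :
    ∃ (w : Fin 24 → ZMod 2) (hw : w ∈ golayCode) (k : Fin 24), signChangeEquiv hw x = oddVec k := by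
  obtain ⟨w, hw, h1⟩ := x.2.exists_signChange_modEq_one hj
  obtain ⟨k, hk⟩ := (x.2.signChange hw).exists_eq_oddVec h1
    (by simpa only [signChange_sq] using hle)
  exact ⟨w, hw, k, Subtype.ext hk⟩

theorem cyc_pow_zero {j : Fin 24} (hj : j ≠ 23) : (cyc ^ j.val) 0 = j := by
  revert j
  decide +kernel

theorem orbit_oddVec (j : Fin 24) : orbit Co0 (toLeech (oddVec j)) =
    orbit Co0 (toLeech (oddVec 0)) := by
  by_cases hj : j = 23
  · subst hj
    let x := sextetEquiv (signChangeEquiv (golayGen_mem_golayCode 22) (oddVec 0))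
    have hx : orbit Co0 (toLeech x) = orbit Co0 (toLeech (oddVec 0)) :=
      (orbit_toLeech_sextetEquiv _).trans (orbit_toLeech_signChangeEquiv _ _)
    have h23 : x.1 23 = 3 := by decide +kernel
    obtain ⟨w, hw, k, hk⟩ := exists_signChangeEquiv_eq_oddVec (x := x) (j := 23) (h23 ▸ by decide)
      ((sum_sq_eq_of_orbit_eq hx).trans (sum_oddVec_sq 0)).le
    have hk23 : (oddVec k).1 23 ^ 2 = 3 ^ 2 := by
      rw [← hk, ← h23]
      exact signChange_sq w x.1 23
    obtain rfl : k = 23 := by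
      by_contra hne
      simp [oddVec_apply, Ne.symm hne] at hk23
    rw [← hk, orbit_toLeech_signChangeEquiv, hx]
  · have hmem := pow_mem cyc_mem_golayAut j.val
    rw [← orbit_toLeech_permEquiv hmem, ← permEquiv_oddVec hmem 0, cyc_pow_zero hj]

theorem cyc_pow_succ_apply (a : ℕ) (i : Fin 24) : (cyc ^ (a + 1)) i = (cyc ^ a) (cyc i) := by
  rw [pow_succ, Equiv.Perm.mul_apply]

theorem tetradSum_comp_cyc_pow (u : Fin 24 → ℤ) (a : ℕ) :
    tetradSum (u ∘ ⇑(cyc ^ a)) 0 =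
      u ((cyc ^ a) 0) + u ((cyc ^ (a + 1)) 0) + u ((cyc ^ (a + 2)) 0) + u 23 := by
  have hcyc : cyc 0 = 1 ∧ cyc 1 = 2 := by decide +kernel
  have hfix : (cyc ^ a) 23 = 23 :=
    Equiv.Perm.pow_apply_eq_self_of_apply_eq_self (by decide +kernel) a
  rw [tetradSum, tetrad_zero, Finset.sum_insert (by decide), Finset.sum_insert (by decide),
    Finset.sum_insert (by decide), Finset.sum_singleton]
  simp only [Function.comp_apply, hfix, cyc_pow_succ_apply, hcyc.1, hcyc.2]
  ring

theorem exists_odd_tetradSum {u : Fin 24 → ℤ} (hu : ¬ ∀ i, u i ≡ u 23 [ZMOD 2]) :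
    ∃ a : ℕ, Odd (tetradSum (u ∘ ⇑(cyc ^ a)) 0) := by
  contrapose! hu
  simp only [Int.not_odd_iff_even, tetradSum_comp_cyc_pow, even_iff_two_dvd] at hu
  let parity (a : ℕ) : ℤ := u ((cyc ^ a) 0) % 2
  have hper3 : parity.Periodic 3 := fun a => by
    have h0 := hu a
    have h1 := hu (a + 1)
    simp only [parity, add_assoc, Nat.reduceAdd] at h0 h1 ⊢
    omega
  have hper23 : parity.Periodic 23 := fun a => by
    have hcyc : cyc ^ 23 = 1 := by decide +kernel
    simp only [parity, pow_add, hcyc, mul_one]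
  have hconst (a : ℕ) : parity a = parity 0 := by
    induction a with
    | zero => rfl
    | succ a ih => exact (hper23 (a + 1)).symm.trans ((hper3.nat_mul 8 a).trans ih)
  intro i
  by_cases hi : i = 23
  · rw [hi]
  · have h0 := hu 0
    have h1 := hconst 1
    have h2 := hconst 2
    have hi' := hconst i
    simp only [parity, zero_add, cyc_pow_zero hi] at h0 h1 h2 hi'
    rw [Int.ModEq]
    omega

theorem exists_orbit_eq_half {x : leechInts} {d : ℤ} {u : Fin 24 → ℤ} (hx : x.1 = (2 * d) • u)
    (hu : ¬ ∀ i, u i ≡ u 23 [ZMOD 2]) :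
    ∃ (y : leechInts) (v : Fin 24 → ℤ) (k : Fin 24),
      orbit Co0 (toLeech y) = orbit Co0 (toLeech x) ∧ y.1 = d • v ∧ Odd (v k) := by
  obtain ⟨a, ha⟩ := exists_odd_tetradSum hu
  have hmem := pow_mem cyc_mem_golayAut a
  set u' := u ∘ ⇑(cyc ^ a) with hu'
  have hsum (b : Fin 6) : tetradSum (x.1 ∘ ⇑(cyc ^ a)) b = 2 * (d * tetradSum u' b) := by
    simp only [hx, hu', tetradSum, Finset.mul_sum, Function.comp_apply, Pi.smul_apply, smul_eq_mul,
      mul_assoc]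
  refine ⟨sextetEquiv (permEquiv hmem x), fun i => (if sextet i = 0 then -1 else 1) *
    (2 * u' i - tetradSum u' (sextet i)), 0, ?_, funext fun i => ?_, ?_⟩
  · rw [orbit_toLeech_sextetEquiv, orbit_toLeech_permEquiv]
  · change sextetMap (x.1 ∘ ⇑(cyc ^ a)) i = _
    rw [sextetMap, hsum, Int.mul_ediv_cancel_left _ two_ne_zero]
    simp only [hx, hu', Function.comp_apply, Pi.smul_apply, smul_eq_mul]
    ring
  · exact Odd.mul (by decide) ((even_two_mul _).sub_odd ha)

theorem not_forall_modEq_of_sum_sq_le {x u : Fin 24 → ℤ} {d : ℤ} {j : Fin 24} (hd : d ≠ 0)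
    (hx : x = (2 * d) • u) (hj : Odd (u j)) (hle : ∑ i, x i ^ 2 ≤ 32) :
    ¬ ∀ i, u i ≡ u 23 [ZMOD 2] := by
  intro hu
  have h4 (i : Fin 24) : 4 ≤ x i ^ 2 := by
    have hi : u i ≡ u j [ZMOD 2] := (hu i).trans (hu j).symm
    have hui : u i ≠ 0 := fun h0 => by
      rw [h0, Int.ModEq, Int.odd_iff.1 hj] at hi
      omega
    have hpos : 0 < (d * u i) ^ 2 := by positivity
    calc 4 ≤ 4 * (d * u i) ^ 2 := by omega
      _ = x i ^ 2 := by rw [hx, Pi.smul_apply, smul_eq_mul]; ring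
  have hsum := Finset.sum_le_sum fun i (_ : i ∈ Finset.univ) => h4 i
  simp only [Finset.sum_const, Finset.card_univ, Fintype.card_fin, nsmul_eq_mul] at hsum
  omega

theorem exists_orbit_eq_odd {d : ℕ} (hd : d ≠ 0) {x : leechInts} {u : Fin 24 → ℤ} {j : Fin 24}
    (hx : x.1 = (d : ℤ) • u) (hj : Odd (u j)) (hle : ∑ i, x.1 i ^ 2 ≤ 32) :
    ∃ (y : leechInts) (k : Fin 24), orbit Co0 (toLeech y) = orbit Co0 (toLeech x) ∧
      Odd (y.1 k) := by
  induction d using Nat.strong_induction_on generalizing x u j with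
  | _ d ih =>
    obtain ⟨e, rfl | rfl⟩ := d.even_or_odd'
    · have hx' : x.1 = (2 * (e : ℤ)) • u := by exact_mod_cast hx
      have he : e ≠ 0 := right_ne_zero_of_mul hd
      obtain ⟨y, v, k, hy, hyv, hk⟩ := exists_orbit_eq_half hx' <|
        not_forall_modEq_of_sum_sq_le (Int.natCast_ne_zero.2 he) hx' hj hle
      obtain ⟨z, l, hz, hl⟩ :=
        ih e (by omega) he hyv hk ((sum_sq_eq_of_orbit_eq hy).trans_le hle)
      exact ⟨z, l, hz.trans hy, hl⟩
    · exact ⟨x, j, rfl, hx ▸ Odd.mul (by simp) hj⟩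

theorem exists_eq_smul_odd {ι : Type*} [Finite ι] [Nonempty ι] (x : ι → ℤ) :
    ∃ (d : ℕ) (u : ι → ℤ) (j : ι), x = (d : ℤ) • u ∧ Odd (u j) := by
  have := Fintype.ofFinite ι
  obtain ⟨u, hu, hgcd⟩ := Finset.univ.extract_gcd x Finset.univ_nonempty
  obtain ⟨j, hj⟩ : ∃ j, Odd (u j) := by
    by_contra! h
    have h2 : (2 : ℤ) ∣ Finset.univ.gcd u :=
      Finset.dvd_gcd fun k _ => (Int.not_odd_iff_even.1 (h k)).two_dvd
    rw [hgcd] at h2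
    omega
  refine ⟨(Finset.univ.gcd x).natAbs, u, j, funext fun k => ?_, hj⟩
  rw [Int.natCast_natAbs, Int.abs_eq_normalize, Finset.normalize_gcd]
  exact hu k (Finset.mem_univ k)

theorem orbit_toLeech_eq {x : leechInts} (hx : x ≠ 0) (hle : ∑ i, x.1 i ^ 2 ≤ 32) :
    orbit Co0 (toLeech x) = orbit Co0 (toLeech (oddVec 0)) := by
  obtain ⟨d, u, j, hxu, hj⟩ := exists_eq_smul_odd x.1
  have hd : d ≠ 0 := by
    rintro rfl
    exact hx (Subtype.ext (hxu.trans (zero_smul ℤ u)))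
  obtain ⟨y, k, hy, hk⟩ := exists_orbit_eq_odd hd hxu hj hle
  obtain ⟨w, hw, l, hl⟩ := exists_signChangeEquiv_eq_oddVec hk
    ((sum_sq_eq_of_orbit_eq hy).trans_le hle)
  rw [← hy, ← orbit_toLeech_signChangeEquiv hw, hl, orbit_oddVec]

theorem toLeech_mem_minimalVectors_iff {x : leechInts} :
    toLeech x ∈ minimalVectors ↔ ∑ i, x.1 i ^ 2 = 32 := by
  have hne (y : leechInts) : toLeech y ≠ 0 ↔ y ≠ 0 := map_ne_zero_iff toLeech toLeech.injective
  have hmin {y : leechInts} (hy : y ≠ 0) : 32 ≤ ∑ i, y.1 i ^ 2 := by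
    by_contra! hlt
    exact hlt.ne ((sum_sq_eq_of_orbit_eq (orbit_toLeech_eq hy hlt.le)).trans (sum_oddVec_sq 0))
  have hne_zero {y : leechInts} (hy : ∑ i, y.1 i ^ 2 = 32) : y ≠ 0 := by
    rintro rfl
    simp at hy
  refine ⟨fun hx => le_antisymm ?_ (hmin ((hne x).1 hx.1)), fun hx =>
    ⟨(hne x).2 (hne_zero hx), fun v hv => ?_⟩⟩
  · rw [← sum_oddVec_sq 0, ← norm_toLeech_le_iff]
    exact hx.2 _ ((hne _).2 (hne_zero (sum_oddVec_sq 0)))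
  · obtain ⟨y, rfl⟩ := toLeech.surjective v
    rw [norm_toLeech_le_iff, hx]
    exact hmin ((hne y).1 hv)

theorem minimalVectors_eq_orbit : minimalVectors = orbit Co0 (toLeech (oddVec 0)) := by
  refine Set.Subset.antisymm (fun v hv => ?_) ?_
  · obtain ⟨x, rfl⟩ := toLeech.surjective v
    have hx : x ≠ 0 := (map_ne_zero_iff toLeech toLeech.injective).1 hv.1
    rw [← orbit_toLeech_eq hx (toLeech_mem_minimalVectors_iff.1 hv).le]
    exact MulAction.mem_orbit_self _
  · rintro _ ⟨g, rfl⟩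
    exact smul_mem_minimalVectors g (toLeech_mem_minimalVectors_iff.2 (sum_oddVec_sq 0))

/-! ### The number of minimal vectors -/

theorem two_mul_card_filter_even_powerset {α : Type*} {s : Finset α}
    (hs : s.Nonempty) : 2 * (s.powerset.filter fun t => Even t.card).card = 2 ^ s.card := by
  have hterm (t : Finset α) : 2 * (if Even t.card then 1 else 0 : ℤ) = 1 + (-1) ^ t.card := by
    split_ifs with h
    · rw [h.neg_one_pow]; rfl
    · rw [(Nat.not_even_iff_odd.1 h).neg_one_pow]; rfl
  have hcast : (2 * (s.powerset.filter fun t => Even t.card).card : ℤ) = 2 ^ s.card := by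
    rw [Finset.card_filter, Nat.cast_sum, Finset.mul_sum]
    push_cast
    simp only [hterm, Finset.sum_add_distrib, Finset.sum_powerset_neg_one_pow_card_of_nonempty hs]
    simp
  exact_mod_cast hcast

/-- The vector with support `A` whose entries are `-c` on `B` and `c` on the rest of `A`
(for `B ⊆ A`). -/
def signedIndicator (c : ℤ) (A B : Finset (Fin 24)) : Fin 24 → ℤ := fun i =>
  if i ∈ B then -c else if i ∈ A then c else 0

theorem signedIndicator_ne_zero {c : ℤ} (hc : c ≠ 0) {A B : Finset (Fin 24)} (hB : B ⊆ A)
    {i : Fin 24} : signedIndicator c A B i ≠ 0 ↔ i ∈ A := by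
  have := @hB i
  simp only [signedIndicator]
  split_ifs <;> simp_all

theorem hammingNorm_signedIndicator {c : ℤ} (hc : c ≠ 0) {A B : Finset (Fin 24)} (hB : B ⊆ A) :
    hammingNorm (signedIndicator c A B) = A.card := by
  simp [hammingNorm, signedIndicator_ne_zero hc hB]

theorem sum_signedIndicator_sq (c : ℤ) {A B : Finset (Fin 24)} (hB : B ⊆ A) :
    ∑ i, signedIndicator c A B i ^ 2 = A.card * c ^ 2 := by
  have hsq (i : Fin 24) : signedIndicator c A B i ^ 2 = if i ∈ A then c ^ 2 else 0 := by
    have := @hB i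
    simp only [signedIndicator]
    split_ifs <;> simp_all
  simp [hsq]

theorem sum_signedIndicator (c : ℤ) {A B : Finset (Fin 24)} (hB : B ⊆ A) :
    ∑ i, signedIndicator c A B i = c * (A.card - 2 * B.card) := by
  have hdiff (i : Fin 24) : signedIndicator c A B i =
      (if i ∈ A then c else 0) - 2 * (if i ∈ B then c else 0) := by
    have := @hB i
    simp only [signedIndicator]
    split_ifs <;> simp_all
    ring
  simp only [hdiff, Finset.sum_sub_distrib, ← Finset.mul_sum, Finset.sum_ite_mem,
    Finset.univ_inter, Finset.sum_const, nsmul_eq_mul]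
  ring

/-- The vectors `signedIndicator c A B` with `A` in the family `𝒜` and `B` in the family `ℬ A`.
Irreducible, lest unification enumerate the vectors. -/
@[irreducible] def signedIndicators (c : ℤ) (𝒜 : Finset (Finset (Fin 24)))
    (ℬ : Finset (Fin 24) → Finset (Finset (Fin 24))) : Finset (Fin 24 → ℤ) :=
  (𝒜.sigma ℬ).image fun p => signedIndicator c p.1 p.2

theorem card_signedIndicators {c : ℤ} (hc : c ≠ 0) {𝒜 : Finset (Finset (Fin 24))}
    {ℬ : Finset (Fin 24) → Finset (Finset (Fin 24))} {n : ℕ} (hℬ : ∀ A ∈ 𝒜, ℬ A ⊆ A.powerset)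
    (hn : ∀ A ∈ 𝒜, (ℬ A).card = n) : (signedIndicators c 𝒜 ℬ).card = 𝒜.card * n := by
  rw [signedIndicators, Finset.card_image_of_injOn, Finset.card_sigma, Finset.sum_const_nat hn]
  rintro ⟨A, B⟩ hA ⟨A', B'⟩ hA' h
  obtain ⟨hA, hB⟩ := Finset.mem_sigma.1 hA
  obtain ⟨hA', hB'⟩ := Finset.mem_sigma.1 hA'
  have hB := Finset.mem_powerset.1 (hℬ A hA hB)
  have hB' := Finset.mem_powerset.1 (hℬ A' hA' hB')
  dsimp only at h
  obtain rfl : A = A' := Finset.ext fun i => by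
    rw [← signedIndicator_ne_zero hc hB, h, signedIndicator_ne_zero hc hB']
  obtain rfl : B = B' := Finset.ext fun i => by
    have hi := congrFun h i
    simp only [signedIndicator] at hi
    split_ifs at hi <;> first | omega | simp_all
  rfl

/-- The octads: the supports of the words of the Golay code with eight nonzero coordinates. -/
def octads : Finset (Finset (Fin 24)) :=
  (golayFinset.filter fun w => hammingNorm w = 8).image fun w => Finset.univ.filter fun i => w i ≠ 0

theorem card_octads : octads.card = 759 := by
  rw [octads, Finset.card_image_of_injective, card_filter_hammingNorm_eq_eight]
  intro v w h
  have hvw (i : Fin 24) : v i ≠ 0 ↔ w i ≠ 0 := by simpa using Finset.ext_iff.1 h i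
  funext i
  have hi := hvw i
  rcases zmod_two_eq_zero_or_one (v i) with hv | hv <;>
    rcases zmod_two_eq_zero_or_one (w i) with hw | hw <;> simp_all

theorem card_eq_eight_of_mem_octads {A : Finset (Fin 24)} (hA : A ∈ octads) : A.card = 8 := by
  simp only [octads, Finset.mem_image, Finset.mem_filter] at hA
  obtain ⟨w, ⟨-, hw⟩, rfl⟩ := hA
  exact hw

theorem isLeechInt_signedIndicator_two {A B : Finset (Fin 24)} (hA : A ∈ octads) (hB : B ⊆ A)
    (heven : Even B.card) : IsLeechInt (signedIndicator 2 A B) := by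
  have hcard := card_eq_eight_of_mem_octads hA
  simp only [octads, Finset.mem_image, Finset.mem_filter, mem_golayFinset] at hA
  obtain ⟨w, ⟨hw, -⟩, rfl⟩ := hA
  refine isLeechInt_iff.2 ⟨0, w, hw, fun i => ?_, ?_⟩
  · rcases zmod_two_eq_zero_or_one (w i) with h | h
    · have hi : i ∉ Finset.univ.filter fun i => w i ≠ 0 := by simp [h]
      rw [not_not.1 (mt (signedIndicator_ne_zero two_ne_zero hB).1 hi), h]
      rfl
    · have hi : i ∈ Finset.univ.filter fun i => w i ≠ 0 := by simp [h]
      rw [signedIndicator, if_pos hi, h]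
      split_ifs <;> rfl
  · rw [sum_signedIndicator 2 hB, hcard]
    obtain ⟨b, hb⟩ := heven
    simp only [Int.ModEq]
    omega

theorem isLeechInt_signedIndicator_four {A B : Finset (Fin 24)} (hA : Even A.card) (hB : B ⊆ A) :
    IsLeechInt (signedIndicator 4 A B) := by
  refine isLeechInt_iff.2 ⟨0, 0, golayCode.zero_mem, fun i => ?_, ?_⟩
  · change signedIndicator 4 A B i ≡ 0 [ZMOD 4]
    simp only [signedIndicator]
    split_ifs <;> rfl
  · rw [sum_signedIndicator 4 hB]
    obtain ⟨a, ha⟩ := hA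
    simp only [Int.ModEq]
    omega

/-- The minimal vectors with odd entries, in integral coordinates. -/
def oddVectors : Finset (Fin 24 → ℤ) :=
  (golayFinset ×ˢ Finset.univ).image fun p => signChange p.1 (oddVec p.2).1

/-- The minimal vectors with entries `±2` on an octad, in integral coordinates. -/
def octadVectors : Finset (Fin 24 → ℤ) :=
  signedIndicators 2 octads fun A => A.powerset.filter fun B => Even B.card

/-- The minimal vectors with two entries `±4`, in integral coordinates. -/
def pairVectors : Finset (Fin 24 → ℤ) :=
  signedIndicators 4 (Finset.univ.powersetCard 2) Finset.powerset

theorem card_oddVectors : oddVectors.card = 24 * 4096 := by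
  rw [oddVectors, Finset.card_image_of_injective, Finset.card_product, card_golayFinset,
    Finset.card_univ, Fintype.card_fin, mul_comm]
  rintro ⟨v, j⟩ ⟨w, k⟩ h
  have happly (i : Fin 24) : signChange v (oddVec j).1 i = signChange w (oddVec k).1 i :=
    congrFun h i
  obtain rfl : j = k := by
    have hsq := congrArg (· ^ 2) (happly j)
    by_contra hjk
    simp [signChange_sq, oddVec_apply, hjk] at hsq
  have hvw : v = w := funext fun i => by
    have hne : (oddVec j).1 i ≠ 0 := by rw [oddVec_apply]; split_ifs <;> decide
    have hval := mul_right_cancel₀ hne (happly i)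
    exact ZMod.val_injective 2 (by omega)
  rw [hvw]

theorem card_octadVectors : octadVectors.card = 759 * 128 := by
  rw [octadVectors, card_signedIndicators two_ne_zero (fun A _ => Finset.filter_subset _ _),
    card_octads]
  intro A hA
  have hcard := card_eq_eight_of_mem_octads hA
  have h := two_mul_card_filter_even_powerset (Finset.card_pos.1 (by omega : 0 < A.card))
  rw [hcard] at h
  omega

theorem card_pairVectors : pairVectors.card = 276 * 4 := by
  rw [pairVectors, card_signedIndicators four_ne_zero (fun A _ => subset_rfl),
    Finset.card_powersetCard]
  · rfl
  · intro A hA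
    rw [Finset.card_powerset, (Finset.mem_powersetCard.1 hA).2]
    rfl

theorem mem_oddVectors {x : Fin 24 → ℤ} (hx : x ∈ oddVectors) :
    IsLeechInt x ∧ ∑ i, x i ^ 2 = 32 ∧ hammingNorm x = 24 := by
  simp only [oddVectors, Finset.mem_image, Finset.mem_product, mem_golayFinset] at hx
  obtain ⟨⟨w, j⟩, ⟨hw, -⟩, rfl⟩ := hx
  refine ⟨(oddVec j).2.signChange hw, ?_, ?_⟩
  · simp only [signChange_sq, sum_oddVec_sq]
  · have hne (i : Fin 24) : signChange w (oddVec j).1 i ≠ 0 := by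
      rw [← pow_ne_zero_iff two_ne_zero, signChange_sq, oddVec_apply]
      split_ifs <;> decide
    simp [hammingNorm, hne]

theorem mem_octadVectors {x : Fin 24 → ℤ} (hx : x ∈ octadVectors) :
    IsLeechInt x ∧ ∑ i, x i ^ 2 = 32 ∧ hammingNorm x = 8 := by
  simp only [octadVectors, signedIndicators, Finset.mem_image, Finset.mem_sigma,
    Finset.mem_filter, Finset.mem_powerset] at hx
  obtain ⟨⟨A, B⟩, ⟨hA, hB, heven⟩, rfl⟩ := hx
  have hcard := card_eq_eight_of_mem_octads hA
  refine ⟨isLeechInt_signedIndicator_two hA hB heven, ?_, ?_⟩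
  · rw [sum_signedIndicator_sq 2 hB, hcard]
    norm_num
  · rw [hammingNorm_signedIndicator two_ne_zero hB, hcard]

theorem mem_pairVectors {x : Fin 24 → ℤ} (hx : x ∈ pairVectors) :
    IsLeechInt x ∧ ∑ i, x i ^ 2 = 32 ∧ hammingNorm x = 2 := by
  simp only [pairVectors, signedIndicators, Finset.mem_image, Finset.mem_sigma,
    Finset.mem_powersetCard, Finset.mem_powerset] at hx
  obtain ⟨⟨A, B⟩, ⟨⟨-, hcard⟩, hB⟩, rfl⟩ := hx
  refine ⟨isLeechInt_signedIndicator_four (by rw [hcard]; exact even_two) hB, ?_, ?_⟩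
  · rw [sum_signedIndicator_sq 4 hB, hcard]
    norm_num
  · rw [hammingNorm_signedIndicator four_ne_zero hB, hcard]

theorem card_le_ncard_minimalVectors {X : Finset (Fin 24 → ℤ)}
    (hX : ∀ x ∈ X, IsLeechInt x ∧ ∑ i, x i ^ 2 = 32) : X.card ≤ minimalVectors.ncard := by
  have : Finite minimalVectors := finite_minimalVectors
  let f (x : X) : minimalVectors :=
    ⟨toLeech ⟨x, (hX x x.2).1⟩, toLeech_mem_minimalVectors_iff.2 (hX x x.2).2⟩
  have hf : Function.Injective f := fun x y h =>
    Subtype.ext (Subtype.mk.inj (toLeech.injective (congrArg Subtype.val h)))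
  rw [← Nat.card_eq_finsetCard, ← Nat.card_coe_set_eq]
  exact Nat.card_le_card_of_injective f hf

theorem disjoint_of_hammingNorm_eq {X Y : Finset (Fin 24 → ℤ)} {m n : ℕ} (hmn : m ≠ n)
    (hX : ∀ x ∈ X, hammingNorm x = m) (hY : ∀ y ∈ Y, hammingNorm y = n) : Disjoint X Y :=
  Finset.disjoint_left.2 fun x hx hy => hmn ((hX x hx).symm.trans (hY x hy))

theorem le_ncard_minimalVectors : 196560 ≤ minimalVectors.ncard := by
  have hoctad : Disjoint oddVectors octadVectors :=
    disjoint_of_hammingNorm_eq (by norm_num : 24 ≠ 8) (fun _ hx => (mem_oddVectors hx).2.2)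
      fun _ hx => (mem_octadVectors hx).2.2
  have hpair : Disjoint (oddVectors ∪ octadVectors) pairVectors :=
    Finset.disjoint_union_left.2
      ⟨disjoint_of_hammingNorm_eq (by norm_num : 24 ≠ 2) (fun _ hx => (mem_oddVectors hx).2.2)
        fun _ hx => (mem_pairVectors hx).2.2,
      disjoint_of_hammingNorm_eq (by norm_num : 8 ≠ 2) (fun _ hx => (mem_octadVectors hx).2.2)
        fun _ hx => (mem_pairVectors hx).2.2⟩
  calc 196560 = 24 * 4096 + 759 * 128 + 276 * 4 := by norm_num
    _ = (oddVectors ∪ octadVectors ∪ pairVectors).card := by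
        rw [Finset.card_union_of_disjoint hpair, Finset.card_union_of_disjoint hoctad,
          card_oddVectors, card_octadVectors, card_pairVectors]
    _ ≤ minimalVectors.ncard := card_le_ncard_minimalVectors fun x hx => by
        rcases Finset.mem_union.1 hx with hx | hx
        · rcases Finset.mem_union.1 hx with hx | hx
          · exact ⟨(mem_oddVectors hx).1, (mem_oddVectors hx).2.1⟩
          · exact ⟨(mem_octadVectors hx).1, (mem_octadVectors hx).2.1⟩
        · exact ⟨(mem_pairVectors hx).1, (mem_pairVectors hx).2.1⟩

/-! ### Disjoint systems of admissible sets -/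

theorem evenFloor_of_even_floor {x : ℝ} (h : Even ⌊x⌋) : evenFloor x = ⌊x⌋ :=
  (isGreatest_evenFloor x).unique
    ⟨⟨h, Int.floor_le x⟩, fun _ hn => Int.le_floor.2 hn.2⟩

theorem ncard_minimalVectors_pos : 0 < minimalVectors.ncard :=
  le_ncard_minimalVectors.trans_lt' (by norm_num)

theorem neg_ne_self_of_mem_minimalVectors {v : leechLattice} (hv : v ∈ minimalVectors) : -v ≠ v :=
  have : IsAddTorsionFree (EuclideanSpace ℝ (Fin 24)) := .of_isTorsionFree ℝ _
  fun h => hv.1 (Subtype.ext (neg_eq_self.1 (congrArg Subtype.val h)))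

theorem biUnion_Icc_update_succ {α : Type*} (T : ℕ → Set α) (k : ℕ) (A : Set α) :
    ⋃ j ∈ Finset.Icc 1 (k + 1), Function.update T (k + 1) A j =
      (⋃ j ∈ Finset.Icc 1 k, T j) ∪ A := by
  rw [← Finset.insert_Icc_right_eq_Icc_add_one (by omega), Finset.set_biUnion_insert,
    Function.update_self, Set.union_comm]
  congr 1
  refine Set.iUnion₂_congr fun j hj => Function.update_of_ne ?_ _ _
  rw [Finset.mem_Icc] at hj
  omega

variable {S A : Set leechLattice} {T : ℕ → Set leechLattice} {k : ℕ}

theorem IsAdmissible.neg_eq (hS : IsAdmissible S) : -S = S :=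
  Set.Subset.antisymm (fun x hx => neg_neg x ▸ hS.antipodal _ hx) hS.antipodal

theorem IsAdmissible.of_subset_smul (hS : IsAdmissible S) {g : Co0} (hA : A ⊆ g • S)
    (hneg : -A = A) : IsAdmissible A where
  minimal := hA.trans <| by
    rintro _ ⟨x, hx, rfl⟩
    exact smul_mem_minimalVectors g (hS.minimal hx)
  antipodal x hx := by rwa [← Set.mem_neg, hneg]
  inner_le := fun x hx y hy hxy => by
    obtain ⟨x, hxS, rfl⟩ := hA hx
    obtain ⟨y, hyS, rfl⟩ := hA hy
    refine le_of_eq_of_le ?_ (hS.inner_le x hxS y hyS fun h => hxy (congrArg _ h))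
    exact inner_map_of_isometry (f := fun z => ((g • z : leechLattice) : EuclideanSpace ℝ (Fin 24)))
      (isometry_subtype_coe.comp (isometry_smul g)) (congrArg Subtype.val g.2) x y

namespace IsDisjointSystem

theorem isAdmissible (hT : IsDisjointSystem S T k) (hk : 1 ≤ k) : IsAdmissible S :=
  hT.first ▸ hT.admissible 1 (Finset.left_mem_Icc.2 hk)

theorem biUnion_subset (hT : IsDisjointSystem S T k) :
    ⋃ j ∈ Finset.Icc 1 k, T j ⊆ minimalVectors :=
  Set.iUnion₂_subset fun j hj => (hT.admissible j hj).minimal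

theorem neg_biUnion_eq (hT : IsDisjointSystem S T k) :
    -(⋃ j ∈ Finset.Icc 1 k, T j) = ⋃ j ∈ Finset.Icc 1 k, T j := by
  simp only [Set.iUnion_neg]
  exact Set.iUnion₂_congr fun j hj => (hT.admissible j hj).neg_eq

theorem ncard_biUnion (hT : IsDisjointSystem S T k) :
    (⋃ j ∈ Finset.Icc 1 k, T j).ncard = ∑ j ∈ Finset.Icc 1 k, (T j).ncard := by
  rw [← finsum_mem_coe_finset]
  exact Set.Finite.ncard_biUnion (Finset.finite_toSet _)
    (fun j hj => finite_minimalVectors.subset (hT.admissible j hj).minimal) hT.disjoint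

theorem expectedOverlap_eq (hT : IsDisjointSystem S T k) (hS : S ⊆ minimalVectors) :
    expectedOverlap S T k =
      S.ncard * (∑ j ∈ Finset.Icc 1 k, ((T j).ncard : ℝ)) / minimalVectors.ncard := by
  have := Fintype.ofFinite Co0
  have hU := hT.biUnion_subset
  rw [minimalVectors_eq_orbit] at hS hU
  have hsum := sum_ncard_smul_inter_mul_ncard_orbit hS hU
  rw [← minimalVectors_eq_orbit, hT.ncard_biUnion] at hsum
  have hM : (minimalVectors.ncard : ℝ) ≠ 0 := Nat.cast_ne_zero.2 ncard_minimalVectors_pos.ne'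
  have hG : (Fintype.card Co0 : ℝ) ≠ 0 := Nat.cast_ne_zero.2 Fintype.card_ne_zero
  simp only [expectedOverlap, translate_eq_smul]
  rw [finsum_eq_sum_of_fintype, Nat.card_eq_fintype_card, div_eq_div_iff hG hM, mul_comm (_ * _)]
  exact_mod_cast hsum

theorem append (hT : IsDisjointSystem S T k) (hk : 1 ≤ k)
    (hA : IsAntipodalPart Co0 S (⋃ j ∈ Finset.Icc 1 k, T j) A) :
    IsDisjointSystem S (Function.update T (k + 1) A) (k + 1) := by
  have hA_disj : ∀ j ∈ Finset.Icc 1 k, Disjoint A (T j) := Set.disjoint_iUnion₂_right.1 hA.disjoint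
  have hupdate : ∀ j ∈ Finset.Icc 1 k, Function.update T (k + 1) A j = T j := fun j hj =>
    Function.update_of_ne (by rw [Finset.mem_Icc] at hj; omega) _ _
  have hnew : Function.update T (k + 1) A (k + 1) = A := Function.update_self ..
  have hIcc : Finset.Icc 1 (k + 1) = insert (k + 1) (Finset.Icc 1 k) :=
    (Finset.insert_Icc_right_eq_Icc_add_one (by omega)).symm
  obtain ⟨g, hg⟩ := hA.subset_smul
  constructor
  · rw [hupdate 1 (Finset.left_mem_Icc.2 hk), hT.first]
  · rw [hIcc, Finset.forall_mem_insert, hnew]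
    refine ⟨(hT.isAdmissible hk).of_subset_smul hg hA.neg_eq, fun j hj => ?_⟩
    rw [hupdate j hj]
    exact hT.admissible j hj
  · rw [hIcc, Finset.forall_mem_insert, hnew]
    refine ⟨⟨g, hg⟩, fun j hj => ?_⟩
    rw [hupdate j hj]
    exact hT.subset_translate j hj
  · intro i hi j hj hij
    rw [hIcc, Finset.mem_insert] at hi hj
    rcases hi with rfl | hi <;> rcases hj with rfl | hj
    · exact absurd rfl hij
    · rw [hnew, hupdate j hj]
      exact hA_disj j hj
    · rw [hnew, hupdate i hi]
      exact (hA_disj i hi).symm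
    · rw [hupdate i hi, hupdate j hj]
      exact hT.disjoint i hi j hj hij

theorem exists_isAntipodalPart_pair (hT : IsDisjointSystem S T k) (hk : 1 ≤ k)
    (hcard : S.ncard ≤ 626) (heven : Even ⌊expectedOverlap S T k⌋) :
    ∃ A B, IsAntipodalPart Co0 S (⋃ j ∈ Finset.Icc 1 k, T j) A ∧
      IsAntipodalPart Co0 S ((⋃ j ∈ Finset.Icc 1 k, T j) ∪ A) B ∧
      ((A.ncard : ℤ) = S.ncard - evenFloor (expectedOverlap S T k) ∧
          (B.ncard : ℤ) = S.ncard - evenFloor (expectedOverlap S T k) ∨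
        (A.ncard : ℤ) = S.ncard - evenFloor (expectedOverlap S T k) + 2 ∧
          (B.ncard : ℤ) = S.ncard - evenFloor (expectedOverlap S T k) - 2) := by
  have hS := hT.isAdmissible hk
  have hE := hT.expectedOverlap_eq hS.minimal
  have hM : (0 : ℝ) < minimalVectors.ncard := Nat.cast_pos.2 ncard_minimalVectors_pos
  rw [evenFloor_of_even_floor heven]
  obtain ⟨m, hm⟩ := Int.eq_ofNat_of_zero_le
    (Int.floor_nonneg.2 (hE ▸ by positivity : 0 ≤ expectedOverlap S T k))
  obtain ⟨hle, hlt⟩ := Int.floor_eq_iff.1 hm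
  rw [hE, le_div_iff₀ hM] at hle
  rw [hE, div_lt_iff₀ hM] at hlt
  have ha : -toLeech (oddVec 0) ≠ toLeech (oddVec 0) :=
    neg_ne_self_of_mem_minimalVectors (minimalVectors_eq_orbit ▸ MulAction.mem_orbit_self _)
  have hsq : S.ncard ^ 2 < 2 * minimalVectors.ncard := by
    nlinarith [le_ncard_minimalVectors]
  have hSM := hS.minimal
  have hUM := hT.biUnion_subset
  rw [minimalVectors_eq_orbit] at hSM hUM hsq hle hlt
  obtain ⟨A, B, hA, hB, hAB⟩ := Leech.exists_isAntipodalPart_pair ha hSM hUM hS.neg_eq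
    hT.neg_biUnion_eq hsq (m := m) (by rw [hm] at heven; exact_mod_cast heven)
    (by rw [hT.ncard_biUnion]; exact_mod_cast hle) (by rw [hT.ncard_biUnion]; exact_mod_cast hlt)
  exact ⟨A, B, hA, hB, by omega⟩

end IsDisjointSystem

end Leech

theorem corollary4p13_general
    (S : Set Leech.leechLattice) (hcard : S.ncard ≤ 626) (k : ℕ) (hk : 1 ≤ k)
    (T : ℕ → Set Leech.leechLattice) (hT : Leech.IsDisjointSystem S T k)
    (heven : Even ⌊Leech.expectedOverlap S T k⌋) :
    ∃ T' : ℕ → Set Leech.leechLattice,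
      (∀ j ∈ Finset.Icc 1 k, T' j = T j) ∧
      Leech.IsDisjointSystem S T' (k + 2) ∧
      Leech.expectedOverlap S T' (k + 2) =
        (S.ncard : ℝ) *
          ((∑ j ∈ Finset.Icc 1 k, ((T j).ncard : ℝ)) +
            2 * ((S.ncard : ℝ) - (Leech.evenFloor (Leech.expectedOverlap S T k) : ℝ))) /
          (Leech.minimalVectors.ncard : ℝ) ∧
      ((T' (k + 1)).ncard : ℤ) + ((T' (k + 2)).ncard : ℤ) ≥
        2 * ((S.ncard : ℤ) - Leech.evenFloor (Leech.expectedOverlap S T k)) ∧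
      2 * ((T' (k + 1)).ncard : ℤ) + ((T' (k + 2)).ncard : ℤ) ≥
        3 * ((S.ncard : ℤ) - Leech.evenFloor (Leech.expectedOverlap S T k)) ∧
      ((((T' (k + 1)).ncard : ℤ) ≥
            (S.ncard : ℤ) - Leech.evenFloor (Leech.expectedOverlap S T k) ∧
          ((T' (k + 2)).ncard : ℤ) ≥
            (S.ncard : ℤ) - Leech.evenFloor (Leech.expectedOverlap S T k)) ∨
        (((T' (k + 1)).ncard : ℤ) ≥
            (S.ncard : ℤ) - Leech.evenFloor (Leech.expectedOverlap S T k) + 2 ∧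
          ((T' (k + 2)).ncard : ℤ) ≥
            (S.ncard : ℤ) - Leech.evenFloor (Leech.expectedOverlap S T k) - 2)) := by
  obtain ⟨A, B, hA, hB, hAB⟩ := hT.exists_isAntipodalPart_pair hk hcard heven
  let T' := Function.update (Function.update T (k + 1) A) (k + 2) B
  have hT' : Leech.IsDisjointSystem S T' (k + 2) :=
    (hT.append hk hA).append (by omega) (by rwa [Leech.biUnion_Icc_update_succ])
  have hold : ∀ j ∈ Finset.Icc 1 k, T' j = T j := fun j hj => by
    have hjk := (Finset.mem_Icc.1 hj).2
    exact (Function.update_of_ne (by omega) _ _).trans (Function.update_of_ne (by omega) _ _)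
  have hTA : T' (k + 1) = A :=
    (Function.update_of_ne (by omega) _ _).trans (Function.update_self ..)
  have hTB : T' (k + 2) = B := Function.update_self ..
  have hsum : (A.ncard : ℝ) + B.ncard =
      2 * (S.ncard - Leech.evenFloor (Leech.expectedOverlap S T k)) := by
    exact_mod_cast (by omega : (A.ncard : ℤ) + B.ncard =
      2 * (S.ncard - Leech.evenFloor (Leech.expectedOverlap S T k)))
  refine ⟨T', hold, hT', ?_, by rw [hTA, hTB]; omega⟩
  rw [hT'.expectedOverlap_eq (hT.isAdmissible hk).minimal, Finset.sum_Icc_succ_top (by omega),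
    Finset.sum_Icc_succ_top (by omega), Finset.sum_congr rfl fun j hj => by rw [hold j hj],
    hTA, hTB, add_assoc, hsum]

theorem corollary4p13
    (S : Set Leech.leechLattice) (hS : Leech.IsAdmissible S) (hcard : S.ncard ≤ 626)
    (k : ℕ) (hk2 : 2 ≤ k) (hk50 : k ≤ 50)
    (T : ℕ → Set Leech.leechLattice) (hT : Leech.IsDisjointSystem S T k)
    (heven : Even ⌊Leech.expectedOverlap S T k⌋) :
    ∃ T' : ℕ → Set Leech.leechLattice,
      (∀ j ∈ Finset.Icc 1 k, T' j = T j) ∧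
      Leech.IsDisjointSystem S T' (k + 2) ∧
      Leech.expectedOverlap S T' (k + 2) =
        (S.ncard : ℝ) *
          ((∑ j ∈ Finset.Icc 1 k, ((T j).ncard : ℝ)) +
            2 * ((S.ncard : ℝ) - (Leech.evenFloor (Leech.expectedOverlap S T k) : ℝ))) /
          (Leech.minimalVectors.ncard : ℝ) ∧
      ((T' (k + 1)).ncard : ℤ) + ((T' (k + 2)).ncard : ℤ) ≥
        2 * ((S.ncard : ℤ) - Leech.evenFloor (Leech.expectedOverlap S T k)) ∧
      2 * ((T' (k + 1)).ncard : ℤ) + ((T' (k + 2)).ncard : ℤ) ≥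
        3 * ((S.ncard : ℤ) - Leech.evenFloor (Leech.expectedOverlap S T k)) ∧
      ((((T' (k + 1)).ncard : ℤ) ≥
            (S.ncard : ℤ) - Leech.evenFloor (Leech.expectedOverlap S T k) ∧
          ((T' (k + 2)).ncard : ℤ) ≥
            (S.ncard : ℤ) - Leech.evenFloor (Leech.expectedOverlap S T k)) ∨
        (((T' (k + 1)).ncard : ℤ) ≥
            (S.ncard : ℤ) - Leech.evenFloor (Leech.expectedOverlap S T k) + 2 ∧
          ((T' (k + 2)).ncard : ℤ) ≥
            (S.ncard : ℤ) - Leech.evenFloor (Leech.expectedOverlap S T k) - 2)) :=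
  corollary4p13_general S hcard k (by omega) T hT heven
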